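/- **Setting.** There are $m$ resources and $n$ products, a consumption matrix $A=[a_{ij}]\in\mathbb N^{m\times n}$ with columns $A^1,\dots,A^n$, an initial inventory $c\in\mathbb N^m$, prices $p\in\mathbb R^n$, a horizon $T>0$, a customer arrival rate $\lambda>0$, a temperature $\gamma\ge 0$, and choice probabilities $P_j(S)\ge 0$ ($S\subseteq\{1,\dots,n\}$, $j\in\{0,1,\dots,n\}$, where $0$ is the no-purchase option) with $P_j(S)=0$ for $1\le j\notin S$ and $\sum_{j\in S\cup\{0\}}P_j(S)=1$. Put $\mathcal X=\prod_{i=1}^m\{0,\dots,c_i\}$, $\mathcal A(x)=\{S: x\ge A^j\ \forall j\in S\}$ and $r(S)=\lambda\sum_{j=1}^n p_jP_j(S)$. Let $\boldsymbol\pi(S\mid t,x)$ be an admissible randomized Markov policy: for each $(t,x)\in[0,T]\times\mathcal X$ it is a probability distribution over assortments $S$, supported on $\mathcal A(x)$, and $t\mapsto\boldsymbol\pi(S\mid t,x)$ is continuous on $[0,T]$. Let $\mathcal H(\boldsymbol\pi(\cdot\mid t,x))=-\sum_{S\in\mathcal A(x)}\boldsymbol\pi(S\mid t,x)\log\boldsymbol\pi(S\mid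 t,x)$, and let $\lambda_j(t,x)=\lambda\sum_{S\in\mathcal A(x)}P_j(S)\boldsymbol\pi(S\mid t,x)$. For $(t,x)\in[0,T]\times\mathcal X$, let $N=N^{t,x}$ be the vector of cumulative sales from time $t$ on, started with inventory $x$ at time $t$, i.e. the Markov jump process on $\mathbb N^n$ with $N_t=0$ and generator $f\mapsto\sum_{j}\lambda_j(s,x-Az)\,[f(z+e_j)-f(z)]$; let $X_s=x-AN_s$. The value function is $$J(t,x;\boldsymbol\pi)=\mathbb E\Big[\int_{(t,T]}p^\top dN_s+\gamma\int_t^T\mathcal H(\boldsymbol\pi(\cdot\mid s,X_{s-}))\,ds\Big].$$ For $x_0\in\mathcal X$, let $\tilde X=\tilde X^{x_0}$ be the exploratory state process with initial state $x_0$, i.e. the Markov jump process on $\mathcal X$, on the time interval $[0,T]$, with $\tilde X_0=x_0$ and generator $g\mapsto\sum_{j}\lambda_j(s,y)\,[g(y-A^j)-g(y)]$. The paths of these processes are right-continuous with left limits. For $v:[0,T]\times\mathcal X\to\mathbb R$ put $$\tilde M^{v,x_0}_t=v(t,\tilde X_t)+\int_0^t\Big\{\sum_{S\in\mathcal A(\tilde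 X_{s-})}r(S)\,\boldsymbol\pi(S\mid s,\tilde X_{s-})+\gamma\,\mathcal H(\boldsymbol\pi(\cdot\mid s,\tilde X_{s-}))\Big\}ds,\qquad t\in[0,T].$$ **Proposition.** Let $v\in C^{1,0}([0,T]\times\mathcal X)$, i.e. $t\mapsto v(t,x)$ is continuously differentiable on $[0,T]$ for each $x\in\mathcal X$. (a) $v(t,x)=J(t,x;\boldsymbol\pi)$ for all $(t,x)\in[0,T]\times\mathcal X$ if and only if $v(T,x)=0$ for all $x\in\mathcal X$ and, for each initial state $x_0\in\mathcal X$, the process $\{\tilde M^{v,x_0}_t:t\in[0,T]\}$ is a square-integrable martingale in the natural filtration of $\tilde X^{x_0}$. (b) Suppose that $v(T,x)=0$ for all $x\in\mathcal X$. Then, for the initial state $c$ alone, $\{\tilde M^{v,c}_t:t\in[0,T]\}$ is a square-integrable martingale in the natural filtration of $\tilde X^{c}$ if and only if $v(t,x)=J(t,x;\boldsymbol\pi)$ for each $x\in\mathcal X$ and each $t$ in the closure of $\{s\in[0,T]:\mathbb P(\tilde X^{c}_s=x)>0\}$. -/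

import Mathlib

open MeasureTheory ProbabilityTheory Set Filter Topology

/-- A choice-based network revenue management model with `m` resources and `n` products:
consumption matrix, initial inventory, fixed prices, Poisson arrival rate of customers, and
choice probabilities. `choiceProb S (some j)` is the probability `P_j(S)` that an arriving
customer who is offered the assortment `S` buys product `j`, and `choiceProb S none` is the
no-purchase probability `P_0(S)`. -/
structure RevenueModel (m n : ℕ) where
  consumption : Matrix (Fin m) (Fin n) ℕ
  inventory : Fin m → ℕ
  price : Fin n → ℝ
  arrivalRate : ℝ
  arrivalRate_pos : 0 < arrivalRate
  choiceProb : Finset (Fin n) → Option (Fin n) → ℝ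
  choiceProb_nonneg : ∀ S j, 0 ≤ choiceProb S j
  choiceProb_eq_zero : ∀ S (j : Fin n), j ∉ S → choiceProb S (some j) = 0
  choiceProb_sum : ∀ S, ∑ j, choiceProb S j = 1

namespace RevenueModel

variable {m n : ℕ} (M : RevenueModel m n)

/-- The state space `{0, …, c_1} × ⋯ × {0, …, c_m}` of remaining inventories. -/
abbrev State : Type := {x : Fin m → ℕ // x ≤ M.inventory}

/-- The state in which the whole initial inventory `c` is still there. -/
def fullState : M.State := ⟨M.inventory, le_refl _⟩

/-- The inventory `x - A z` that is left of `x` after `z j` sales of each product `j`. The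
subtraction is truncated at `0`; this never plays a role for a process with admissible
policy, because a product is sold only if the inventory suffices. -/
def remaining (x : M.State) (z : Fin n → ℕ) : M.State :=
  ⟨fun i => x.1 i - M.consumption.mulVec z i, fun i => (Nat.sub_le _ _).trans (x.2 i)⟩

/-- The inventory `x - A^j` after one sale of product `j`. -/
def afterSale (x : M.State) (j : Fin n) : M.State := M.remaining x (Pi.single j 1)

open Classical in
/-- The available actions `𝒜(x)`: the assortments `S` such that `x ≥ A^j` for all `j ∈ S`. -/
noncomputable def available (x : M.State) : Finset (Finset (Fin n)) :=
  Finset.univ.filter fun S => ∀ j ∈ S, ∀ i, M.consumption i j ≤ x.1 i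

/-- The reward rate `r(S) = λ ∑_j p_j P_j(S)`. -/
noncomputable def rewardRate (S : Finset (Fin n)) : ℝ :=
  M.arrivalRate * ∑ j, M.price j * M.choiceProb S (some j)

/-- `π t x S` stands for `π(S ∣ t, x)`. The predicate says that `π`, restricted to times in
`[0, T]`, is an admissible randomized Markov policy. -/
structure IsAdmissible (T : ℝ) (π : ℝ → M.State → Finset (Fin n) → ℝ) : Prop where
  measurable : ∀ x S, Measurable fun t : Icc (0 : ℝ) T => π t x S
  nonneg : ∀ t ∈ Icc (0 : ℝ) T, ∀ x S, 0 ≤ π t x S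
  sum_eq_one : ∀ t ∈ Icc (0 : ℝ) T, ∀ x, ∑ S, π t x S = 1
  eq_zero : ∀ t ∈ Icc (0 : ℝ) T, ∀ x, ∀ S ∉ M.available x, π t x S = 0
  continuousOn : ∀ x S, ContinuousOn (fun t => π t x S) (Icc 0 T)

variable (π : ℝ → M.State → Finset (Fin n) → ℝ)

/-- The entropy `ℋ(π(· ∣ t, x)) = - ∑_{S ∈ 𝒜(x)} π(S ∣ t, x) log π(S ∣ t, x)`
(with `0 log 0 = 0`). -/
noncomputable def entropy (t : ℝ) (x : M.State) : ℝ :=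
  -∑ S ∈ M.available x, π t x S * Real.log (π t x S)

/-- The rate `λ ∑_{S ∈ 𝒜(x)} P_j(S) π(S ∣ t, x)` at which product `j` is sold in state `x`
at time `t`. -/
noncomputable def saleRate (t : ℝ) (x : M.State) (j : Fin n) : ℝ :=
  M.arrivalRate * ∑ S ∈ M.available x, M.choiceProb S (some j) * π t x S

/-- The generator of the cumulative sales when the inventory at time `0` of the count is `x`:
`(L_t f)(z) = ∑_j saleRate(t, x - A z, j) (f(z + e_j) - f(z))`. -/
noncomputable def salesGenerator (x : M.State) (t : ℝ) (f : (Fin n → ℕ) → ℝ)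
    (z : Fin n → ℕ) : ℝ :=
  ∑ j, M.saleRate π t (M.remaining x z) j * (f (z + Pi.single j 1) - f z)

/-- The generator of the inventory:
`(L_t g)(x) = ∑_j saleRate(t, x, j) (g(x - A^j) - g(x))`. -/
noncomputable def stateGenerator (t : ℝ) (g : M.State → ℝ) (x : M.State) : ℝ :=
  ∑ j, M.saleRate π t x j * (g (M.afterSale x j) - g x)

end RevenueModel

section MarkovJump

variable {Ω E : Type*} [mΩ : MeasurableSpace Ω]
  [TopologicalSpace E] [TopologicalSpace.MetrizableSpace E] [MeasurableSpace E] [BorelSpace E]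

/-- The natural filtration, on the time interval `[t₀, T]`, of a process `X`. -/
def pathFiltration (t₀ T : ℝ) (X : ℝ → Ω → E)
    (hX : ∀ t : Icc t₀ T, StronglyMeasurable (X t)) : Filtration (Icc t₀ T) mΩ :=
  Filtration.natural (fun t : Icc t₀ T => X t) hX

/-- On the time interval `[t₀, T]` (all that is said about `X` concerns times in this interval),
`X` is a Markov jump process with values in a countable discrete space `E`, with start in `x₀` at
time `t₀` and with time-dependent generator `L`: its paths are right-continuous with left limits
and it solves the martingale problem for `L`, that is, for each bounded `f` the process
`f(X_t) - ∫_{t₀}^t (L_s f)(X_s) ds` is a martingale in the natural filtration of `X`. -/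
structure IsMarkovJump (t₀ T : ℝ) (L : ℝ → (E → ℝ) → E → ℝ) (x₀ : E)
    (P : Measure Ω) (X : ℝ → Ω → E) : Prop where
  stronglyMeasurable : ∀ t : Icc t₀ T, StronglyMeasurable (X t)
  right_continuous : ∀ ω, ∀ t ∈ Ico t₀ T, ContinuousWithinAt (fun s => X s ω) (Ici t) t
  left_limits : ∀ ω, ∀ t ∈ Ioc t₀ T, ∃ y, Tendsto (fun s => X s ω) (𝓝[<] t) (𝓝 y)
  start : ∀ᵐ ω ∂P, X t₀ ω = x₀
  martingale_problem : ∀ f : E → ℝ, (∃ C, ∀ y, |f y| ≤ C) →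
    Martingale (fun (t : Icc t₀ T) ω => f (X t ω) - ∫ s in t₀..(t : ℝ), L s f (X s ω))
      (pathFiltration t₀ T X stronglyMeasurable) P

end MarkovJump

namespace RevenueModel

variable {m n : ℕ} (M : RevenueModel m n) {Ω : Type*} [MeasurableSpace Ω]

/-- `N` is the vector of cumulative sales `N^π` under the policy `π` from time `t` on, if the
inventory at time `t` is `x`; the sample state process is then `X^π_s = x - A N_s`. -/
def IsSalesDynamics (T : ℝ) (π : ℝ → M.State → Finset (Fin n) → ℝ) (t : ℝ) (x : M.State)
    (P : Measure Ω) (N : ℝ → Ω → Fin n → ℕ) : Prop :=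
  IsMarkovJump t T (M.salesGenerator π x) 0 P N

/-- `X` is the exploratory state process under the policy `π` on `[0, T]`, with `X_0 = x`. -/
def IsExploratoryDynamics (T : ℝ) (π : ℝ → M.State → Finset (Fin n) → ℝ) (x : M.State)
    (P : Measure Ω) (X : ℝ → Ω → M.State) : Prop :=
  IsMarkovJump 0 T (M.stateGenerator π) x P X

/-- The value function
`J(t, x; π) = E[∫_{(t, T]} pᵀ dN_s + γ ∫_t^T ℋ(π(· ∣ s, X_{s-})) ds ∣ X_t = x]`,
where for each `(t, x)` the expectation is that of the sales process `N t x` started at time `t`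
with inventory `x`, under the probability measure `Q t x`. -/
noncomputable def valueFunction (T γ : ℝ) (π : ℝ → M.State → Finset (Fin n) → ℝ)
    (Q : ℝ → M.State → Measure Ω) (N : ℝ → M.State → ℝ → Ω → Fin n → ℕ)
    (t : ℝ) (x : M.State) : ℝ :=
  ∫ ω, ((∑ j, M.price j * ((N t x T ω j : ℝ) - (N t x t ω j : ℝ)))
    + γ * ∫ s in t..T,
        M.entropy π s (Function.leftLim (fun u => M.remaining x (N t x u ω)) s)) ∂(Q t x)

/-- The process `M^v_t = v(t, X_t) + ∫_0^t {∑_{S ∈ 𝒜(X_{s-})} r(S) π(S ∣ s, X_{s-})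
+ γ ℋ(π(· ∣ s, X_{s-}))} ds`. -/
noncomputable def accumulatedValue (γ : ℝ) (π : ℝ → M.State → Finset (Fin n) → ℝ)
    (v : ℝ → M.State → ℝ) (X : ℝ → Ω → M.State) (t : ℝ) (ω : Ω) : ℝ :=
  v t (X t ω) + ∫ s in (0 : ℝ)..t,
    ((∑ S ∈ M.available (Function.leftLim (fun u => X u ω) s),
        M.rewardRate S * π s (Function.leftLim (fun u => X u ω) s) S)
      + γ * M.entropy π s (Function.leftLim (fun u => X u ω) s))

/-- The process `M^v_t`, `t ∈ [0, T]`, is a square-integrable martingale in the natural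
filtration of `X`. -/
def IsSquareIntegrableValueMartingale (T γ : ℝ) (π : ℝ → M.State → Finset (Fin n) → ℝ)
    (v : ℝ → M.State → ℝ) (P : Measure Ω) (X : ℝ → Ω → M.State)
    (hX : ∀ t : Icc 0 T, StronglyMeasurable (X t)) : Prop :=
  Martingale (fun t : Icc 0 T => M.accumulatedValue γ π v X t) (pathFiltration 0 T X hX) P
    ∧ ∀ t : Icc 0 T, MemLp (M.accumulatedValue γ π v X t) 2 P

end RevenueModel

/-!
The idea is to compare `v` with the solution `u` of the backward equation
`∂ₜu + Lₜu + r = 0`, `u(T, ·) = 0`, where `Lₜ` is the generator of the inventory and `r` the running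
reward (revenue rate plus `γ` times entropy). The state space is finite, so this is a linear ODE with
continuous coefficients and `u` exists on all of `[0, T]` (`exists_backward_linear_ode`).

Everything else follows from Dynkin's formula for time-dependent functions (`dynkin_formula`). It is
proved without stochastic integration: under any finite measure `μ` for which the martingale problem
holds in mean, the masses `μ(Y_s = x)` solve the forward equation `φ' = Lₛᵀφ`, so `∑ₓ u(s, x) φₓ(s)`
can be differentiated. Applied to the restriction of the probability measure to events in the past,
the formula gives martingales; no uniqueness for the martingale problem and no Markov property is
used.

* For the sales process, the remaining inventory solves the martingale problem for `L`, and the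
  expected sales of each product are the expected time integral of its sale rate (the martingale
  problem for the bounded functions `z ↦ min (z j) k`, as `k → ∞`). Hence the value
  function `J` is `u`
  (`valueFunction_eq_of_solvesBackwardEquation`).
* For the exploratory process, `M^u` is a bounded martingale. If `v(T, ·) = 0` and `M^v` is a
  martingale as well, then `M^v - M^u = (v - u)(t, X_t)` is a martingale with terminal value `0`, so it
  vanishes almost surely. Conversely, if it vanishes then `M^v` is a modification of the martingale
  `M^u` (`IsExploratoryDynamics.isSquareIntegrableValueMartingale_iff`).

So the martingale property of `M^v` says that `v = u = J` at every `(t, x)` with `P(X_t = x) > 0`. For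
a single initial state this extends to the closure by continuity; if every initial state is allowed,
all `(t, x)` are covered, because the process started in `x` is still in `x` at time `t` with positive
probability (`IsExploratoryDynamics.measure_eq_start_ne_zero`).
-/

/-! ### Right-continuous paths -/

section Paths

/-- A right-continuous path in a discrete space is constant on some `[t, t + ε)`, so the times at
which it jumps are isolated from the right, hence countable. -/
theorem countable_leftLim_ne {E : Type*} [TopologicalSpace E] [DiscreteTopology E] {a b : ℝ}
    {y : ℝ → E} (hr : ∀ t ∈ Ico a b, ContinuousWithinAt y (Ici t) t) :
    {t ∈ Ioo a b | Function.leftLim y t ≠ y t}.Countable := by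
  refine (countable_setOfPred_isolated_right_within
    (s := {t ∈ Ioo a b | Function.leftLim y t ≠ y t})).mono ?_
  intro t ht
  refine mem_ofPred.2 ⟨ht, ?_⟩
  obtain ⟨⟨hat, htb⟩, -⟩ := ht
  have h1 : ∀ᶠ s in 𝓝[≥] t, y s = y t := by
    have := hr t ⟨hat.le, htb⟩
    rw [ContinuousWithinAt, nhds_discrete, tendsto_pure] at this
    exact this
  obtain ⟨c, htc, hc⟩ := (mem_nhdsGE_iff_exists_Ico_subset).1 h1
  rw [← empty_mem_iff_bot]
  have h2 : Ioo t c ∈ 𝓝[>] t := Ioo_mem_nhdsGT htc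
  have h3 : {t ∈ Ioo a b | Function.leftLim y t ≠ y t} ∩ Ioi t ∩ Ioo t c = ∅ := by
    refine eq_empty_iff_forall_notMem.2 ?_
    rintro s ⟨⟨⟨-, hs⟩, -⟩, hts, hsc⟩
    refine hs (leftLim_eq_of_tendsto ?_)
    have hev : ∀ᶠ q in 𝓝[<] s, y q = y s := by
      filter_upwards [Ioo_mem_nhdsLT hts] with q hq
      rw [hc ⟨hq.1.le, hq.2.trans hsc⟩, hc ⟨hts.le, hsc⟩]
    exact tendsto_const_nhds.congr' (hev.mono fun _ h => h.symm)
  rw [← h3]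
  refine inter_mem self_mem_nhdsWithin ?_
  exact nhdsWithin_mono _ inter_subset_right h2

theorem ae_leftLim_eq {E : Type*} [TopologicalSpace E] [DiscreteTopology E] {a b : ℝ}
    {y : ℝ → E} (hr : ∀ t ∈ Ico a b, ContinuousWithinAt y (Ici t) t) :
    ∀ᵐ t, t ∈ Ioc a b → Function.leftLim y t = y t := by
  have h := (countable_leftLim_ne hr).ae_notMem volume
  have hb : ∀ᵐ t : ℝ, t ≠ b := by simp [ae_iff]
  filter_upwards [h, hb] with t ht htb hmem
  by_contra hne
  exact ht ⟨⟨hmem.1, lt_of_le_of_ne hmem.2 htb⟩, hne⟩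

/-- A right-continuous process is jointly measurable: it is the limit of the processes that are
sampled at the next point of a grid of mesh `1 / (k + 1)`. -/
theorem measurable_uncurry_of_rightContinuous {Ω E : Type*} [MeasurableSpace Ω]
    [TopologicalSpace E] [TopologicalSpace.PseudoMetrizableSpace E] [MeasurableSpace E]
    [BorelSpace E] {Y : ℝ → Ω → E} (hm : ∀ s, Measurable (Y s))
    (hr : ∀ ω s, ContinuousWithinAt (fun s => Y s ω) (Ici s) s) :
    Measurable (Function.uncurry Y) := by
  let d : ℕ → ℝ → ℝ := fun k s => (⌊(k + 1 : ℝ) * s⌋ + 1 : ℝ) / (k + 1)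
  have hd : ∀ s, Tendsto (fun k => d k s) atTop (𝓝[≥] s) := by
    intro s
    have hlow : ∀ k, s ≤ d k s := fun k => by
      have hk : (0 : ℝ) < k + 1 := by positivity
      rw [le_div_iff₀ hk, mul_comm]
      exact (Int.lt_floor_add_one _).le
    have hup : ∀ k, d k s ≤ s + 1 / ((k : ℝ) + 1) := fun k => by
      have hk : (0 : ℝ) < k + 1 := by positivity
      rw [div_le_iff₀ hk, add_mul s, one_div, inv_mul_cancel₀ hk.ne', mul_comm s]
      exact add_le_add_left (Int.floor_le _) _
    refine tendsto_nhdsWithin_iff.2 ⟨?_, .of_forall hlow⟩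
    refine tendsto_of_tendsto_of_tendsto_of_le_of_le tendsto_const_nhds ?_ hlow hup
    simpa using (tendsto_one_div_add_atTop_nhds_zero_nat (𝕜 := ℝ)).const_add s
  refine measurable_of_tendsto_metrizable (f := fun k (p : ℝ × Ω) => Y (d k p.1) p.2) ?_ ?_
  · intro k
    have h1 : Measurable fun q : ℤ × Ω => Y ((q.1 + 1 : ℝ) / (k + 1)) q.2 :=
      measurable_from_prod_countable_right fun i => hm (((i : ℝ) + 1) / (k + 1))
    have h2 : Measurable fun p : ℝ × Ω => (⌊(k + 1 : ℝ) * p.1⌋, p.2) :=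
      ((measurable_fst.const_mul _).floor).prodMk measurable_snd
    exact h1.comp h2
  · refine tendsto_pi_nhds.2 fun p => ?_
    exact (hr p.2 p.1).tendsto.comp (hd p.1)

/-- Freezing a path outside of `[a, b]` keeps it right-continuous, now at all times. -/
theorem continuousWithinAt_comp_projIcc {E : Type*} [TopologicalSpace E] {a b : ℝ} (hab : a ≤ b)
    {y : ℝ → E} (hr : ∀ t ∈ Ico a b, ContinuousWithinAt y (Ici t) t) (s : ℝ) :
    ContinuousWithinAt (fun s => y (projIcc a b hab s)) (Ici s) s := by
  rcases lt_or_ge s b with hs | hs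
  · rcases hab.eq_or_lt with rfl | hab'
    · have h : ∀ r, (projIcc a a hab r : ℝ) = a := fun r => le_antisymm (projIcc a a hab r).2.2
        (projIcc a a hab r).2.1
      simpa only [h] using continuousWithinAt_const
    refine ContinuousWithinAt.comp (t := Ici (projIcc a b hab s : ℝ)) (hr _ ⟨?_, ?_⟩)
      (continuous_subtype_val.comp continuous_projIcc).continuousWithinAt ?_
    · exact (projIcc a b hab s).2.1
    · simp [coe_projIcc, hs, hab']
    · intro r hr
      exact monotone_projIcc hab hr
  · refine (continuousWithinAt_const (b := y b)).congr (fun r hr => ?_) ?_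
    · simp only [projIcc_of_right_le hab (hs.trans hr)]
    · simp only [projIcc_of_right_le hab hs]

theorem measurable_uncurry_comp_projIcc {Ω E : Type*} [MeasurableSpace Ω]
    [TopologicalSpace E] [TopologicalSpace.PseudoMetrizableSpace E] [MeasurableSpace E]
    [BorelSpace E] {a b : ℝ} (hab : a ≤ b) {Y : ℝ → Ω → E} (hm : ∀ s ∈ Icc a b, Measurable (Y s))
    (hr : ∀ ω, ∀ t ∈ Ico a b, ContinuousWithinAt (fun s => Y s ω) (Ici t) t) :
    Measurable fun p : ℝ × Ω => Y (projIcc a b hab p.1) p.2 :=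
  measurable_uncurry_of_rightContinuous (Y := fun s => Y (projIcc a b hab s))
    (fun s => hm _ (projIcc a b hab s).2)
    fun ω s => continuousWithinAt_comp_projIcc hab (hr ω) s

end Paths

/-! ### Linear differential equations on a compact interval -/

section LinearODE

open scoped NNReal Matrix

variable {E : Type*} [Fintype E]

/-- Componentwise truncation of a vector to the cube `[-R, R]^E`. -/
noncomputable def clampVec (R : ℝ) (w : E → ℝ) : E → ℝ := fun i => max (-R) (min R (w i))

theorem lipschitzWith_clampVec (R : ℝ) : LipschitzWith 1 (clampVec (E := E) R) := by
  refine LipschitzWith.of_dist_le_mul fun w z => ?_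
  rw [NNReal.coe_one, one_mul]
  refine (dist_pi_le_iff dist_nonneg).2 fun i => le_trans ?_ (dist_le_pi_dist w z i)
  rw [Real.dist_eq, Real.dist_eq]
  refine (abs_max_sub_max_le_max _ _ _ _).trans ?_
  rw [sub_self, abs_zero, max_eq_right (abs_nonneg _)]
  refine (abs_min_sub_min_le_max _ _ _ _).trans ?_
  rw [sub_self, abs_zero, max_eq_right (abs_nonneg _)]

theorem norm_clampVec_le {R : ℝ} (hR : 0 ≤ R) (w : E → ℝ) : ‖clampVec R w‖ ≤ R :=
  (pi_norm_le_iff_of_nonneg hR).2 fun i =>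
    abs_le.2 ⟨le_max_left _ _, max_le (by linarith) (min_le_left _ _)⟩

theorem clampVec_of_norm_le {R : ℝ} {w : E → ℝ} (h : ‖w‖ ≤ R) : clampVec R w = w := by
  funext i
  have := abs_le.1 ((norm_le_pi_norm w i).trans h)
  simp only [clampVec]
  rw [min_eq_right this.2, max_eq_right this.1]

theorem norm_clampVec_le_norm {R : ℝ} (hR : 0 ≤ R) (w : E → ℝ) : ‖clampVec R w‖ ≤ ‖w‖ := by
  have h0 : clampVec R (0 : E → ℝ) = 0 := clampVec_of_norm_le (by simpa using hR)
  have := (lipschitzWith_clampVec R).dist_le_mul w 0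
  simpa [h0] using this

theorem norm_mulVec_le_of_norm_entry_le {G : Matrix E E ℝ} {C : ℝ} (hC : 0 ≤ C)
    (hG : ∀ x y, |G x y| ≤ C) (w : E → ℝ) : ‖G *ᵥ w‖ ≤ Fintype.card E * C * ‖w‖ := by
  refine (pi_norm_le_iff_of_nonneg (by positivity)).2 fun x => ?_
  rw [Matrix.mulVec, dotProduct]
  calc ‖∑ y, G x y * w y‖ ≤ ∑ y, ‖G x y * w y‖ := norm_sum_le _ _
    _ ≤ ∑ _y : E, C * ‖w‖ := by
      refine Finset.sum_le_sum fun y _ => ?_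
      rw [norm_mul]
      exact mul_le_mul (hG x y) (norm_le_pi_norm w y) (norm_nonneg _) hC
    _ = _ := by simp [mul_assoc]

theorem exists_forall_abs_le_of_continuousOn {ι : Type*} [Finite ι] {a b : ℝ} {f : ℝ → ι → ℝ}
    (hf : ∀ i, ContinuousOn (fun t => f t i) (Icc a b)) :
    ∃ C, 0 ≤ C ∧ ∀ t ∈ Icc a b, ∀ i, |f t i| ≤ C := by
  have := Fintype.ofFinite ι
  obtain ⟨C, hC⟩ := isCompact_Icc.exists_bound_of_continuousOn (continuousOn_pi.2 hf)
  refine ⟨max C 0, le_max_right _ _, fun t ht i => ?_⟩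
  exact (norm_le_pi_norm (f t) i).trans ((hC t ht).trans (le_max_left _ _))

/-- A linear ODE with continuous coefficients has a solution on the whole interval. -/
theorem exists_forward_linear_ode {T : ℝ} (hT : 0 ≤ T) {G : ℝ → Matrix E E ℝ} {h : ℝ → E → ℝ}
    (hG : ∀ x y, ContinuousOn (fun t => G t x y) (Icc 0 T))
    (hh : ∀ x, ContinuousOn (fun t => h t x) (Icc 0 T)) :
    ∃ w : ℝ → E → ℝ, w 0 = 0 ∧
      ∀ t ∈ Icc 0 T, HasDerivWithinAt w (G t *ᵥ w t + h t) (Icc 0 T) t := by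
  obtain ⟨C, hC0, hC⟩ := exists_forall_abs_le_of_continuousOn
    (f := fun t (p : E × E) => G t p.1 p.2)
    fun p => hG p.1 p.2
  obtain ⟨H, hH0, hH⟩ := exists_forall_abs_le_of_continuousOn hh
  set K : ℝ := Fintype.card E * C with hK
  have hK0 : 0 ≤ K := by positivity
  have hmul : ∀ t ∈ Icc 0 T, ∀ z : E → ℝ, ‖G t *ᵥ z‖ ≤ K * ‖z‖ := fun t ht z =>
    norm_mulVec_le_of_norm_entry_le hC0 (fun x y => hC t ht (x, y)) z
  have hhn : ∀ t ∈ Icc 0 T, ‖h t‖ ≤ H := fun t ht =>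
    (pi_norm_le_iff_of_nonneg hH0).2 (hH t ht)
  set R : ℝ := gronwallBound 0 K H T with hR
  have hR0 : 0 ≤ R := by
    have := gronwallBound_mono le_rfl hH0 hK0 hT
    rwa [gronwallBound_x0] at this
  -- With `z` clamped at the a priori bound `R`, the vector field is bounded, so that the
  -- Picard-Lindelöf theorem gives a solution on all of `[0, T]`. By Grönwall's inequality this
  -- solution stays below `R`, where the clamping has no effect.
  let f : ℝ → (E → ℝ) → E → ℝ := fun t z => G t *ᵥ clampVec R z + h t
  have hpl : IsPicardLindelof f (⟨0, le_rfl, hT⟩ : Icc 0 T) (0 : E → ℝ)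
      (⟨(K * R + H) * T, by positivity⟩ : ℝ≥0) 0 (⟨K * R + H, by positivity⟩ : ℝ≥0)
      (⟨K, hK0⟩ : ℝ≥0) := by
    refine ⟨fun t ht => ?_, fun z _ => ?_, fun t ht z _ => ?_, ?_⟩
    · refine LipschitzWith.lipschitzOnWith (LipschitzWith.of_dist_le_mul fun z z' => ?_)
      simp only [f, dist_add_right]
      rw [dist_eq_norm, ← Matrix.mulVec_sub]
      refine (hmul t ht _).trans ?_
      rw [← dist_eq_norm]
      refine mul_le_mul_of_nonneg_left ?_ hK0
      simpa using (lipschitzWith_clampVec R).dist_le_mul z z'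
    · refine continuousOn_pi.2 fun x => ?_
      simp only [f, Pi.add_apply, Matrix.mulVec, dotProduct]
      exact (continuousOn_finsetSum _ fun y _ => (hG x y).mul continuousOn_const).add (hh x)
    · refine (norm_add_le _ _).trans (add_le_add ((hmul t ht _).trans ?_) (hhn t ht))
      exact mul_le_mul_of_nonneg_left (norm_clampVec_le hR0 z) hK0
    · change (K * R + H) * max (T - 0) (0 - 0) ≤ (K * R + H) * T - 0
      simp [hT]
  obtain ⟨w, hw0, hw⟩ := hpl.exists_eq_forall_mem_Icc_hasDerivWithinAt₀
  refine ⟨w, hw0, fun t ht => ?_⟩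
  have hbound : ∀ s ∈ Icc 0 T, ‖w s‖ ≤ gronwallBound 0 K H (s - 0) := by
    refine norm_le_gronwallBound_of_norm_deriv_right_le (f' := fun s => f s (w s))
      (fun s hs => (hw s hs).continuousWithinAt) (fun s hs => ?_) (by rw [hw0, norm_zero])
      fun s hs => ?_
    · exact (hw s (Ico_subset_Icc_self hs)).mono_of_mem_nhdsWithin
        (Icc_mem_nhdsGE_of_mem hs)
    · have hs' := Ico_subset_Icc_self hs
      refine (norm_add_le _ _).trans (add_le_add ((hmul s hs' _).trans ?_) (hhn s hs'))
      exact mul_le_mul_of_nonneg_left (norm_clampVec_le_norm hR0 _) hK0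
  have hle : ‖w t‖ ≤ R := (hbound t ht).trans
    (gronwallBound_mono le_rfl hH0 hK0 (by linarith [ht.2]))
  have := hw t ht
  simpa only [f, clampVec_of_norm_le hle] using this

/-- The backward equation `u' + G u + h = 0` with terminal value `0`, by reversal of time. -/
theorem exists_backward_linear_ode {T : ℝ} (hT : 0 ≤ T) {G : ℝ → Matrix E E ℝ} {h : ℝ → E → ℝ}
    (hG : ∀ x y, ContinuousOn (fun t => G t x y) (Icc 0 T))
    (hh : ∀ x, ContinuousOn (fun t => h t x) (Icc 0 T)) :
    ∃ u : ℝ → E → ℝ, (∀ x, u T x = 0) ∧ (∀ x, ContinuousOn (fun t => u t x) (Icc 0 T)) ∧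
      ∀ t ∈ Ioo 0 T, ∀ x, HasDerivAt (fun t => u t x) (-(G t *ᵥ u t) x - h t x) t := by
  have hmaps : MapsTo (fun t : ℝ => T - t) (Icc 0 T) (Icc 0 T) := fun t ht =>
    ⟨by linarith [ht.2], by linarith [ht.1]⟩
  have hc : ContinuousOn (fun t : ℝ => T - t) (Icc 0 T) := by fun_prop
  obtain ⟨w, hw0, hw⟩ := exists_forward_linear_ode hT (G := fun t => G (T - t))
    (h := fun t => h (T - t)) (fun x y => (hG x y).comp hc hmaps) fun x => (hh x).comp hc hmaps
  refine ⟨fun t => w (T - t), fun x => by simp [hw0], fun x => ?_, fun t ht x => ?_⟩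
  · have hwc : ContinuousOn w (Icc 0 T) := fun t ht => (hw t ht).continuousWithinAt
    exact (continuousOn_pi.1 hwc x).comp hc hmaps
  · have hs : T - t ∈ Ioo 0 T := ⟨by linarith [ht.2], by linarith [ht.1]⟩
    have h1 := (hw _ (Ioo_subset_Icc_self hs)).hasDerivAt (Icc_mem_nhds hs.1 hs.2)
    have h2 := (hasDerivAt_pi.1 h1 x).comp_const_sub T t
    convert! h2 using 1
    simp only [sub_sub_cancel, Pi.add_apply]
    ring

end LinearODE

/-! ### Time integrals along a path -/

section PathIntegrals

variable {Ω E : Type*} {a b C : ℝ} {Y : ℝ → Ω → E} {κ : ℝ → E → ℝ}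

theorem intervalIntegral_comp_path_eq (hab : a ≤ b) (ω : Ω) :
    ∫ s in a..b, κ s (Y s ω) =
      ∫ s in a..b, κ (projIcc a b hab s) (Y (projIcc a b hab s) ω) := by
  refine intervalIntegral.integral_congr fun s hs => ?_
  rw [uIcc_of_le hab] at hs
  simp only [projIcc_of_mem hab hs]

theorem abs_intervalIntegral_path_le (hab : a ≤ b)
    (hC : ∀ t ∈ Icc a b, ∀ x, |κ t x| ≤ C) (ω : Ω) :
    |∫ s in a..b, κ s (Y s ω)| ≤ C * (b - a) := by
  have := intervalIntegral.norm_integral_le_of_norm_le_const (a := a) (b := b) (C := C)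
    (f := fun s => κ s (Y s ω)) fun s hs => by
      rw [uIoc_of_le hab] at hs
      exact hC s (Ioc_subset_Icc_self hs) _
  rwa [abs_of_nonneg (sub_nonneg.2 hab)] at this

variable [MeasurableSpace Ω] [Countable E] [TopologicalSpace E] [DiscreteTopology E]
  [MeasurableSpace E] [BorelSpace E]

theorem measurable_comp_path_projIcc (hab : a ≤ b) (hm : ∀ s ∈ Icc a b, Measurable (Y s))
    (hr : ∀ ω, ∀ t ∈ Ico a b, ContinuousWithinAt (fun s => Y s ω) (Ici t) t)
    (hκ : ∀ x, ContinuousOn (fun t => κ t x) (Icc a b)) :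
    Measurable fun p : ℝ × Ω => κ (projIcc a b hab p.1) (Y (projIcc a b hab p.1) p.2) := by
  have h1 : Measurable fun q : ℝ × E => κ (projIcc a b hab q.1) q.2 := by
    refine measurable_from_prod_countable_left fun x => Continuous.measurable ?_
    exact (hκ x).comp_continuous (continuous_subtype_val.comp continuous_projIcc)
      fun s => (projIcc a b hab s).2
  exact h1.comp (measurable_fst.prodMk (measurable_uncurry_comp_projIcc hab hm hr))

/-- The σ-algebra on `Ω` is arbitrary here; for the past up to time `b` this is adaptedness of the
time integral. -/
theorem stronglyMeasurable_intervalIntegral_path (hab : a ≤ b)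
    (hm : ∀ s ∈ Icc a b, Measurable (Y s))
    (hr : ∀ ω, ∀ t ∈ Ico a b, ContinuousWithinAt (fun s => Y s ω) (Ici t) t)
    (hκ : ∀ x, ContinuousOn (fun t => κ t x) (Icc a b)) :
    StronglyMeasurable fun ω => ∫ s in a..b, κ s (Y s ω) := by
  rw [funext fun ω => (intervalIntegral_comp_path_eq hab ω).trans
    (intervalIntegral.integral_of_le hab)]
  exact (measurable_comp_path_projIcc hab hm hr hκ).stronglyMeasurable.integral_prod_left'

theorem integrable_prod_path (hab : a ≤ b) (hm : ∀ s ∈ Icc a b, Measurable (Y s))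
    (hr : ∀ ω, ∀ t ∈ Ico a b, ContinuousWithinAt (fun s => Y s ω) (Ici t) t)
    (hκ : ∀ x, ContinuousOn (fun t => κ t x) (Icc a b))
    (hC : ∀ t ∈ Icc a b, ∀ x, |κ t x| ≤ C) (μ : Measure Ω) [IsFiniteMeasure μ] :
    Integrable (Function.uncurry fun s ω => κ s (Y s ω))
      ((volume.restrict (uIoc a b)).prod μ) := by
  have : IsFiniteMeasure (volume.restrict (uIoc a b)) := by
    rw [uIoc_of_le hab]; infer_instance
  have h1 : Integrable (fun p : ℝ × Ω => κ (projIcc a b hab p.1) (Y (projIcc a b hab p.1) p.2))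
      ((volume.restrict (uIoc a b)).prod μ) :=
    Integrable.of_bound (measurable_comp_path_projIcc hab hm hr hκ).aestronglyMeasurable C
      (.of_forall fun p => hC _ (projIcc a b hab p.1).2 _)
  refine h1.congr ?_
  have hmem : ∀ᵐ s ∂(volume.restrict (uIoc a b)), s ∈ uIoc a b :=
    ae_restrict_mem measurableSet_uIoc
  filter_upwards [Measure.quasiMeasurePreserving_fst.ae hmem] with p hp
  rw [uIoc_of_le hab] at hp
  simp only [Function.uncurry, projIcc_of_mem hab (Ioc_subset_Icc_self hp)]

theorem intervalIntegrable_path (hab : a ≤ b) (hm : ∀ s ∈ Icc a b, Measurable (Y s))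
    (hr : ∀ ω, ∀ t ∈ Ico a b, ContinuousWithinAt (fun s => Y s ω) (Ici t) t)
    (hκ : ∀ x, ContinuousOn (fun t => κ t x) (Icc a b))
    (hC : ∀ t ∈ Icc a b, ∀ x, |κ t x| ≤ C) (ω : Ω) :
    IntervalIntegrable (fun s => κ s (Y s ω)) volume a b := by
  have h := integrable_prod_path hab hm hr hκ hC (Measure.dirac ω)
  have hconst : IntervalIntegrable (fun _ : ℝ => C) volume a b := intervalIntegrable_const
  refine hconst.mono_fun' (f := fun s => κ s (Y s ω)) ?_ ?_
  · have h2 := (measurable_comp_path_projIcc hab hm hr hκ).comp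
      (measurable_id.prodMk (measurable_const (a := ω)))
    refine h2.aestronglyMeasurable.congr ?_
    refine (ae_restrict_iff' measurableSet_uIoc).2 (.of_forall fun s hs => ?_)
    rw [uIoc_of_le hab] at hs
    simp only [Function.comp, id, projIcc_of_mem hab (Ioc_subset_Icc_self hs)]
  · refine (ae_restrict_iff' measurableSet_uIoc).2 (.of_forall fun s hs => ?_)
    rw [uIoc_of_le hab] at hs
    exact hC s (Ioc_subset_Icc_self hs) _

theorem integrable_intervalIntegral_path (hab : a ≤ b) (hm : ∀ s ∈ Icc a b, Measurable (Y s))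
    (hr : ∀ ω, ∀ t ∈ Ico a b, ContinuousWithinAt (fun s => Y s ω) (Ici t) t)
    (hκ : ∀ x, ContinuousOn (fun t => κ t x) (Icc a b))
    (hC : ∀ t ∈ Icc a b, ∀ x, |κ t x| ≤ C) (μ : Measure Ω) [IsFiniteMeasure μ] :
    Integrable (fun ω => ∫ s in a..b, κ s (Y s ω)) μ := by
  have h := (integrable_prod_path hab hm hr hκ hC μ).integral_prod_right
  simpa only [intervalIntegral.integral_of_le hab, uIoc_of_le hab, Function.uncurry] using h

end PathIntegrals

/-! ### Dynkin's formula on a finite state space -/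

section Dynkin

open scoped Matrix

variable {Ω E : Type*} [MeasurableSpace Ω] [Fintype E] [TopologicalSpace E] [DiscreteTopology E]
  [MeasurableSpace E] [BorelSpace E] {a b : ℝ} {Y : ℝ → Ω → E} {κ : ℝ → E → ℝ}
  {μ : Measure Ω} [IsFiniteMeasure μ]

theorem integral_comp_eq_sum {Z : Ω → E} (hZ : Measurable Z) (f : E → ℝ) :
    ∫ ω, f (Z ω) ∂μ = ∑ x, f x * μ.real (Z ⁻¹' {x}) := by
  rw [← integral_map (μ := μ) (φ := Z) (f := f) hZ.aemeasurable
    (measurable_of_countable f).aestronglyMeasurable,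
    integral_fintype .of_finite]
  refine Finset.sum_congr rfl fun x _ => ?_
  rw [smul_eq_mul, mul_comm, map_measureReal_apply hZ (measurableSet_singleton x)]

/-- Fubini: the expected time integral of `κ s (Y s)` in terms of the masses `μ (Y s = x)`. -/
theorem integral_intervalIntegral_path (hab : a ≤ b) (hm : ∀ s ∈ Icc a b, Measurable (Y s))
    (hr : ∀ ω, ∀ t ∈ Ico a b, ContinuousWithinAt (fun s => Y s ω) (Ici t) t)
    (hκ : ∀ x, ContinuousOn (fun t => κ t x) (Icc a b)) :
    ∫ ω, (∫ s in a..b, κ s (Y s ω)) ∂μ = ∫ s in a..b, ∑ x, κ s x * μ.real (Y s ⁻¹' {x}) := by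
  obtain ⟨C, -, hC⟩ := exists_forall_abs_le_of_continuousOn hκ
  rw [← intervalIntegral_integral_swap (integrable_prod_path hab hm hr hκ hC μ)]
  refine intervalIntegral.integral_congr fun s hs => ?_
  rw [uIcc_of_le hab] at hs
  exact integral_comp_eq_sum (hm s hs) (κ s)

theorem intervalIntegrable_measureReal_path (hab : a ≤ b) (hm : ∀ s ∈ Icc a b, Measurable (Y s))
    (hr : ∀ ω, ∀ t ∈ Ico a b, ContinuousWithinAt (fun s => Y s ω) (Ici t) t) (x : E) :
    IntervalIntegrable (fun s => μ.real (Y s ⁻¹' {x})) volume a b := by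
  classical
  have h := (integrable_prod_path (κ := fun _ => Pi.single x (1 : ℝ)) (C := 1) hab hm hr
    (fun _ => continuousOn_const) (fun t _ y => by
      by_cases hy : y = x <;> simp [hy]) μ).integral_prod_left
  rw [uIoc_of_le hab] at h
  rw [intervalIntegrable_iff_integrableOn_Ioc_of_le hab]
  refine h.congr ((ae_restrict_iff' measurableSet_Ioc).2 (.of_forall fun s hs => ?_))
  simp only [Function.uncurry]
  rw [integral_comp_eq_sum (hm s (Ioc_subset_Icc_self hs))]
  simp [Pi.single_apply]

/-- Dynkin's formula for a function `u` that solves `u' + G u + h = 0`. The process is assumed to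
solve the martingale problem for `G` only in mean (`hY`); the finite measure `μ` is meant to be the
restriction of a probability measure to an event in the past of time `a`. -/
theorem dynkin_formula (hab : a ≤ b) (hm : ∀ s ∈ Icc a b, Measurable (Y s))
    (hr : ∀ ω, ∀ t ∈ Ico a b, ContinuousWithinAt (fun s => Y s ω) (Ici t) t)
    {G : ℝ → Matrix E E ℝ} (hG : ∀ x y, ContinuousOn (fun t => G t x y) (Icc a b))
    (hY : ∀ f : E → ℝ, ∀ r ∈ Icc a b,
      ∫ ω, f (Y r ω) ∂μ = ∫ ω, f (Y a ω) ∂μ + ∫ ω, (∫ s in a..r, (G s *ᵥ f) (Y s ω)) ∂μ)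
    {u h : ℝ → E → ℝ} (hu : ∀ x, ContinuousOn (fun t => u t x) (Icc a b))
    (hh : ∀ x, ContinuousOn (fun t => h t x) (Icc a b))
    (hode : ∀ t ∈ Ioo a b, ∀ x, HasDerivAt (fun t => u t x) (-(G t *ᵥ u t) x - h t x) t) :
    ∫ ω, u b (Y b ω) ∂μ + ∫ ω, (∫ s in a..b, h s (Y s ω)) ∂μ = ∫ ω, u a (Y a ω) ∂μ := by
  classical
  let φ : ℝ → E → ℝ := fun s x => μ.real (Y s ⁻¹' {x})
  -- the law of the process solves the forward equation, in integrated form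
  have hfor : ∀ x, ∀ r ∈ Icc a b, φ r x = φ a x + ∫ s in a..r, ∑ y, G s y x * φ s y := by
    intro x r hr'
    have hGf : ∀ s, G s *ᵥ (Pi.single x (1 : ℝ)) = fun y => G s y x := fun s => by
      rw [Matrix.mulVec_single_one]; rfl
    have hsub : Icc a r ⊆ Icc a b := Icc_subset_Icc_right hr'.2
    have h1 := hY (Pi.single x 1) r hr'
    simp only [hGf] at h1
    rw [integral_intervalIntegral_path (κ := fun s y => G s y x) hr'.1
      (fun s hs => hm s (hsub hs)) (fun ω t ht => hr ω t ⟨ht.1, ht.2.trans_le hr'.2⟩)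
      fun y => (hG y x).mono hsub, integral_comp_eq_sum (hm r hr'),
      integral_comp_eq_sum (hm a ⟨le_rfl, hab⟩)] at h1
    simpa [Pi.single_apply] using h1
  -- hence the law is continuous in time, and then even differentiable
  have hint : ∀ x, IntervalIntegrable (fun s => ∑ y, G s y x * φ s y) volume a b := fun x => by
    have h1 := IntervalIntegrable.sum (μ := volume) (a := a) (b := b) Finset.univ
      (f := fun y s => G s y x * φ s y) fun y _ =>
      (intervalIntegrable_measureReal_path (μ := μ) hab hm hr y).continuousOn_mul
        (by rw [uIcc_of_le hab]; exact hG y x)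
    simpa only [Finset.sum_fn] using h1
  have hφc : ∀ x, ContinuousOn (fun s => φ s x) (Icc a b) := fun x => by
    have h1 := intervalIntegral.continuousOn_primitive_interval' (hint x) left_mem_uIcc
    rw [uIcc_of_le hab] at h1
    exact (continuousOn_const.add h1).congr (hfor x)
  have hgc : ∀ x, ContinuousOn (fun s => ∑ y, G s y x * φ s y) (Icc a b) := fun x =>
    continuousOn_finsetSum _ fun y _ => (hG y x).mul (hφc y)
  have hφd : ∀ x, ∀ t ∈ Ioo a b, HasDerivAt (fun s => φ s x) (∑ y, G t y x * φ t y) t := by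
    intro x t ht
    have hIoo := (hgc x).mono Ioo_subset_Icc_self
    have h1 := intervalIntegral.integral_hasDerivAt_right
      ((hint x).mono_set (by
        rw [uIcc_of_le hab, uIcc_of_le ht.1.le]; exact Icc_subset_Icc_right ht.2.le))
      (hIoo.stronglyMeasurableAtFilter isOpen_Ioo t ht) (hIoo.continuousAt (Ioo_mem_nhds ht.1 ht.2))
    refine (h1.const_add (φ a x)).congr_of_eventuallyEq ?_
    filter_upwards [Icc_mem_nhds ht.1 ht.2] with s hs using hfor x s hs
  have hftc := intervalIntegral.integral_eq_sub_of_hasDerivAt_of_le hab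
    (f := fun t => ∑ x, u t x * φ t x) (f' := fun t => -∑ x, h t x * φ t x)
    (continuousOn_finsetSum _ fun x _ => (hu x).mul (hφc x)) (fun t ht => ?_)
    (ContinuousOn.intervalIntegrable (by
      rw [uIcc_of_le hab]
      exact (continuousOn_finsetSum _ fun x _ => (hh x).mul (hφc x)).neg))
  · rw [intervalIntegral.integral_neg, ← integral_intervalIntegral_path hab hm hr hh] at hftc
    rw [integral_comp_eq_sum (hm b ⟨hab, le_rfl⟩), integral_comp_eq_sum (hm a ⟨le_rfl, hab⟩)]
    simp only [φ] at hftc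
    linarith
  · have h1 := HasDerivAt.fun_sum (u := Finset.univ) fun x _ => (hode t ht x).mul (hφd x t ht)
    refine h1.congr_deriv ?_
    rw [Finset.sum_add_distrib]
    -- the generator and its transpose cancel
    have h2 : ∑ x, u t x * ∑ y, G t y x * φ t y = ∑ x, (G t *ᵥ u t) x * φ t x := by
      simp only [Matrix.mulVec, dotProduct, Finset.mul_sum, Finset.sum_mul]
      rw [Finset.sum_comm]
      exact Finset.sum_congr rfl fun x _ => Finset.sum_congr rfl fun y _ => by ring
    rw [h2, ← Finset.sum_add_distrib, ← Finset.sum_neg_distrib]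
    exact Finset.sum_congr rfl fun x _ => by ring

end Dynkin

namespace RevenueModel

open scoped Matrix

/-! ### The generator and the running reward of the revenue model -/

section Model

variable {m n : ℕ} (M : RevenueModel m n)

instance : Finite M.State :=
  Finite.of_injective (fun x i => (⟨x.1 i, Nat.lt_succ_of_le (x.2 i)⟩ : Fin (M.inventory i + 1)))
    fun _ _ h => Subtype.ext (funext fun i => congrArg Fin.val (congrFun h i))

noncomputable instance : Fintype M.State := Fintype.ofFinite _

theorem remaining_zero (x : M.State) : M.remaining x 0 = x := by
  refine Subtype.ext (funext fun i => ?_)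
  simp [remaining]

/-- This holds for all `z`, because truncated subtraction satisfies `a - (b + c) = a - b - c`. -/
theorem remaining_add_single (x : M.State) (z : Fin n → ℕ) (j : Fin n) :
    M.remaining x (z + Pi.single j 1) = M.afterSale (M.remaining x z) j := by
  refine Subtype.ext (funext fun i => ?_)
  simp [remaining, afterSale, Matrix.mulVec_add, Nat.sub_sub]

variable (π : ℝ → M.State → Finset (Fin n) → ℝ)

/-- The matrix of the linear operator `stateGenerator`. -/
noncomputable def generatorMatrix (t : ℝ) : Matrix M.State M.State ℝ :=
  Matrix.of fun x y => M.stateGenerator π t (Pi.single y 1) x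

theorem generatorMatrix_mulVec (t : ℝ) (g : M.State → ℝ) :
    M.generatorMatrix π t *ᵥ g = M.stateGenerator π t g := by
  funext x
  have h : ∀ z, ∑ y, (Pi.single y (1 : ℝ) : M.State → ℝ) z * g y = g z := fun z => by
    simp [Pi.single_apply]
  simp only [Matrix.mulVec, dotProduct, generatorMatrix, Matrix.of_apply, stateGenerator,
    Finset.sum_mul]
  rw [Finset.sum_comm]
  refine Finset.sum_congr rfl fun j _ => ?_
  simp only [mul_assoc, ← Finset.mul_sum, sub_mul, Finset.sum_sub_distrib, h]

/-- On functions of the remaining inventory, the generator of the sales acts as that of the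
inventory. Hence the remaining inventory solves the martingale problem for the inventory. -/
theorem salesGenerator_comp_remaining (x : M.State) (t : ℝ) (g : M.State → ℝ)
    (z : Fin n → ℕ) :
    M.salesGenerator π x t (fun z => g (M.remaining x z)) z =
      (M.generatorMatrix π t *ᵥ g) (M.remaining x z) := by
  rw [generatorMatrix_mulVec]
  simp only [salesGenerator, stateGenerator, remaining_add_single]

/-- The rate `∑_S r(S) π(S ∣ t, x) + γ ℋ(π(· ∣ t, x))` at which the entropy-regularized reward
accumulates in state `x` at time `t`. -/
noncomputable def runningReward (γ t : ℝ) (x : M.State) : ℝ :=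
  (∑ S ∈ M.available x, M.rewardRate S * π t x S) + γ * M.entropy π t x

/-- The reward rate of the offered assortments is the revenue rate of the products. -/
theorem runningReward_eq (γ t : ℝ) (x : M.State) :
    M.runningReward π γ t x =
      ∑ j, M.price j * M.saleRate π t x j + γ * M.entropy π t x := by
  simp only [runningReward, rewardRate, saleRate, Finset.mul_sum, Finset.sum_mul]
  rw [Finset.sum_comm]
  congr 1
  exact Finset.sum_congr rfl fun j _ => Finset.sum_congr rfl fun S _ => by ring

variable {M π} {T : ℝ}

theorem IsAdmissible.continuousOn_saleRate (hπ : M.IsAdmissible T π) (x : M.State) (j : Fin n) :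
    ContinuousOn (fun t => M.saleRate π t x j) (Icc 0 T) :=
  continuousOn_const.mul (continuousOn_finsetSum _ fun S _ =>
    continuousOn_const.mul (hπ.continuousOn x S))

theorem IsAdmissible.continuousOn_entropy (hπ : M.IsAdmissible T π) (x : M.State) :
    ContinuousOn (fun t => M.entropy π t x) (Icc 0 T) :=
  (continuousOn_finsetSum _ fun S _ =>
    Real.continuous_mul_log.comp_continuousOn (hπ.continuousOn x S)).neg

theorem IsAdmissible.continuousOn_runningReward (hπ : M.IsAdmissible T π) (γ : ℝ) (x : M.State) :
    ContinuousOn (fun t => M.runningReward π γ t x) (Icc 0 T) :=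
  (continuousOn_finsetSum _ fun S _ => continuousOn_const.mul (hπ.continuousOn x S)).add
    (continuousOn_const.mul (hπ.continuousOn_entropy x))

theorem IsAdmissible.continuousOn_generatorMatrix (hπ : M.IsAdmissible T π) (x y : M.State) :
    ContinuousOn (fun t => M.generatorMatrix π t x y) (Icc 0 T) := by
  simp only [generatorMatrix, Matrix.of_apply, stateGenerator]
  exact continuousOn_finsetSum _ fun j _ => (hπ.continuousOn_saleRate x j).mul continuousOn_const

theorem IsAdmissible.saleRate_nonneg (hπ : M.IsAdmissible T π) {t : ℝ} (ht : t ∈ Icc 0 T)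
    (x : M.State) (j : Fin n) : 0 ≤ M.saleRate π t x j :=
  mul_nonneg M.arrivalRate_pos.le (Finset.sum_nonneg fun S _ =>
    mul_nonneg (M.choiceProb_nonneg S _) (hπ.nonneg t ht x S))

theorem IsAdmissible.generatorMatrix_nonneg (hπ : M.IsAdmissible T π) {t : ℝ} (ht : t ∈ Icc 0 T)
    {x y : M.State} (hxy : x ≠ y) : 0 ≤ M.generatorMatrix π t x y := by
  simp only [generatorMatrix, Matrix.of_apply, stateGenerator]
  refine Finset.sum_nonneg fun j _ => mul_nonneg (hπ.saleRate_nonneg ht x j) ?_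
  rw [Pi.single_eq_of_ne hxy, sub_zero, Pi.single_apply]
  split_ifs <;> norm_num

/-- `u` solves the backward equation `∂ₜu + Lu + r = 0` on `[0, T]` with terminal value `0`,
where `r` is the running reward. The derivative is asked for in the open interval only, which with
continuity up to the end points is all that the fundamental theorem of calculus needs. -/
structure SolvesBackwardEquation (M : RevenueModel m n) (T γ : ℝ)
    (π : ℝ → M.State → Finset (Fin n) → ℝ) (u : ℝ → M.State → ℝ) : Prop where
  terminal : ∀ x, u T x = 0
  continuousOn : ∀ x, ContinuousOn (fun t => u t x) (Icc 0 T)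
  hasDerivAt : ∀ t ∈ Ioo 0 T, ∀ x, HasDerivAt (fun t => u t x)
    (-(M.generatorMatrix π t *ᵥ u t) x - M.runningReward π γ t x) t

theorem IsAdmissible.exists_solvesBackwardEquation (hπ : M.IsAdmissible T π) (hT : 0 ≤ T)
    (γ : ℝ) : ∃ u, M.SolvesBackwardEquation T γ π u := by
  obtain ⟨u, h1, h2, h3⟩ := exists_backward_linear_ode hT hπ.continuousOn_generatorMatrix
    (hπ.continuousOn_runningReward γ)
  exact ⟨u, h1, h2, h3⟩

end Model

end RevenueModel

/-! ### Markov jump processes on a countable state space -/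

section MarkovJump

variable {Ω E : Type*} [MeasurableSpace Ω] [TopologicalSpace E]
  [TopologicalSpace.MetrizableSpace E] [MeasurableSpace E] [BorelSpace E]
  {t₀ T : ℝ} {L : ℝ → (E → ℝ) → E → ℝ} {x₀ : E} {P : Measure Ω} {X : ℝ → Ω → E}

theorem IsMarkovJump.measurable (hX : IsMarkovJump t₀ T L x₀ P X) :
    ∀ s ∈ Icc t₀ T, Measurable (X s) :=
  fun s hs => (hX.stronglyMeasurable ⟨s, hs⟩).measurable

theorem measurable_pathFiltration (hX : ∀ t : Icc t₀ T, StronglyMeasurable (X t))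
    {s : ℝ} {t : Icc t₀ T} (hs : s ∈ Icc t₀ t) : Measurable[pathFiltration t₀ T X hX t] (X s) :=
  ((Filtration.stronglyAdapted_natural hX ⟨s, hs.1, hs.2.trans t.2.2⟩).mono
    ((Filtration.natural _ hX).mono (show (⟨s, _⟩ : Icc t₀ T) ≤ t from hs.2))).measurable

/-- The martingale problem, integrated over an event `A` in the past of time `s`. -/
theorem IsMarkovJump.setIntegral_eq [Countable E] [DiscreteTopology E] [IsProbabilityMeasure P]
    (hX : IsMarkovJump t₀ T L x₀ P X) {f : E → ℝ} {C D : ℝ} (hf : ∀ y, |f y| ≤ D)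
    (hL : ∀ y, ContinuousOn (fun s => L s f y) (Icc t₀ T))
    (hC : ∀ s ∈ Icc t₀ T, ∀ y, |L s f y| ≤ C) {s r : ℝ} (hs : s ∈ Icc t₀ T) (hr : r ∈ Icc s T)
    {A : Set Ω} (hA : MeasurableSet[pathFiltration t₀ T X hX.stronglyMeasurable ⟨s, hs⟩] A) :
    ∫ ω in A, f (X r ω) ∂P =
      ∫ ω in A, f (X s ω) ∂P + ∫ ω in A, (∫ q in s..r, L q f (X q ω)) ∂P := by
  have hr0 : r ∈ Icc t₀ T := ⟨hs.1.trans hr.1, hr.2⟩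
  have hint : ∀ q ∈ Icc t₀ T, Integrable (fun ω => ∫ q in t₀..q, L q f (X q ω)) P := fun q hq =>
    integrable_intervalIntegral_path (κ := fun s => L s f) hq.1
      (fun s hs => hX.measurable s ⟨hs.1, hs.2.trans hq.2⟩)
      (fun ω t ht => hX.right_continuous ω t ⟨ht.1, ht.2.trans_le hq.2⟩)
      (fun y => (hL y).mono (Icc_subset_Icc_right hq.2))
      (fun s hs => hC s ⟨hs.1, hs.2.trans hq.2⟩) P
  have hpath : ∀ a b, t₀ ≤ a → a ≤ b → b ≤ T → ∀ ω,
      IntervalIntegrable (fun q => L q f (X q ω)) volume a b := fun a b ha hab hb ω =>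
    intervalIntegrable_path (κ := fun s => L s f) hab
      (fun s hs => hX.measurable s ⟨ha.trans hs.1, hs.2.trans hb⟩)
      (fun ω t ht => hX.right_continuous ω t ⟨ha.trans ht.1, ht.2.trans_le hb⟩)
      (fun y => (hL y).mono (Icc_subset_Icc ha hb))
      (fun s hs => hC s ⟨ha.trans hs.1, hs.2.trans hb⟩) ω
  have hfint : ∀ q ∈ Icc t₀ T, Integrable (fun ω => f (X q ω)) P := fun q hq =>
    Integrable.of_bound ((measurable_of_countable f).comp
      (hX.measurable q hq)).aestronglyMeasurable D (.of_forall fun ω => hf _)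
  have h := (hX.martingale_problem f ⟨D, hf⟩).setIntegral_eq
    (show (⟨s, hs⟩ : Icc t₀ T) ≤ ⟨r, hr0⟩ from hr.1) hA
  rw [integral_sub (hfint s hs).integrableOn (hint s hs).integrableOn,
    integral_sub (hfint r hr0).integrableOn (hint r hr0).integrableOn] at h
  have hsplit : ∀ ω, ∫ q in s..r, L q f (X q ω) =
      (∫ q in t₀..r, L q f (X q ω)) - ∫ q in t₀..s, L q f (X q ω) := fun ω =>
    (intervalIntegral.integral_interval_sub_left (hpath _ _ le_rfl hr0.1 hr0.2 ω)
      (hpath _ _ le_rfl hs.1 hs.2 ω)).symm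
  simp only [hsplit]
  rw [integral_sub (hint r hr0).integrableOn (hint s hs).integrableOn]
  linarith

end MarkovJump

namespace RevenueModel

open scoped Matrix

/-! ### The exploratory process -/

section Exploratory

variable {m n : ℕ} {M : RevenueModel m n} {T γ : ℝ} {π : ℝ → M.State → Finset (Fin n) → ℝ}
  {Ω : Type*} {X : ℝ → Ω → M.State} {u v : ℝ → M.State → ℝ}

/-- The left limits in `accumulatedValue` may be replaced by the values of the path, since they
differ at countably many times only. -/
theorem accumulatedValue_eq (hr : ∀ ω, ∀ t ∈ Ico 0 T, ContinuousWithinAt (fun s => X s ω) (Ici t) t)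
    {t : ℝ} (ht : t ∈ Icc 0 T) (ω : Ω) :
    M.accumulatedValue γ π v X t ω =
      v t (X t ω) + ∫ s in 0..t, M.runningReward π γ s (X s ω) := by
  rw [accumulatedValue]
  congr 1
  refine intervalIntegral.integral_congr_ae ?_
  filter_upwards [ae_leftLim_eq (a := 0) (b := t) (y := fun s => X s ω)
    fun q hq => hr ω q ⟨hq.1, hq.2.trans_le ht.2⟩] with s hs hmem
  rw [uIoc_of_le ht.1] at hmem
  rw [hs hmem, runningReward]

variable [MeasurableSpace Ω] {P : Measure Ω} {x₀ : M.State}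

theorem IsExploratoryDynamics.stronglyMeasurable_accumulatedValue
    (hX : M.IsExploratoryDynamics T π x₀ P X) (hπ : M.IsAdmissible T π)
    (v : ℝ → M.State → ℝ) (t : Icc 0 T) :
    StronglyMeasurable[pathFiltration 0 T X hX.stronglyMeasurable t]
      (M.accumulatedValue γ π v X t) := by
  rw [funext (accumulatedValue_eq hX.right_continuous t.2)]
  refine StronglyMeasurable.add ?_ ?_
  · exact ((measurable_of_countable (v t)).comp
      (measurable_pathFiltration hX.stronglyMeasurable ⟨t.2.1, le_rfl⟩)).stronglyMeasurable
  · exact @stronglyMeasurable_intervalIntegral_path _ _ _ _ _ _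
      (pathFiltration 0 T X hX.stronglyMeasurable t) _ _ _ _ _ t.2.1
      (fun s hs => measurable_pathFiltration hX.stronglyMeasurable hs)
      (fun ω s hs => hX.right_continuous ω s ⟨hs.1, hs.2.trans_le t.2.2⟩)
      fun x => (hπ.continuousOn_runningReward γ x).mono (Icc_subset_Icc_right t.2.2)

theorem IsExploratoryDynamics.exists_abs_accumulatedValue_le
    (hX : M.IsExploratoryDynamics T π x₀ P X) (hπ : M.IsAdmissible T π)
    (v : ℝ → M.State → ℝ) (t : Icc 0 T) :
    ∃ C, ∀ ω, |M.accumulatedValue γ π v X t ω| ≤ C := by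
  obtain ⟨C, -, hC⟩ := exists_forall_abs_le_of_continuousOn (hπ.continuousOn_runningReward γ)
  refine ⟨‖v t‖ + C * (t - 0), fun ω => ?_⟩
  rw [accumulatedValue_eq hX.right_continuous t.2]
  refine (abs_add_le _ _).trans (add_le_add (norm_le_pi_norm (v t) _) ?_)
  exact abs_intervalIntegral_path_le t.2.1 (fun s hs => hC s ⟨hs.1, hs.2.trans t.2.2⟩) ω

theorem eq_of_ae_eq_of_measure_ne_zero {t : ℝ} {x : M.State}
    (h : ∀ᵐ ω ∂P, v t (X t ω) = u t (X t ω)) (hx : P {ω | X t ω = x} ≠ 0) : v t x = u t x := by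
  by_contra hne
  refine hx (measure_mono_null (fun ω hω => ?_) h)
  rw [mem_compl_iff, mem_ofPred_eq, show X t ω = x from hω]
  exact hne

variable [IsProbabilityMeasure P]

theorem IsExploratoryDynamics.dynkin (hX : M.IsExploratoryDynamics T π x₀ P X)
    (hπ : M.IsAdmissible T π) {h : ℝ → M.State → ℝ}
    (hu : ∀ x, ContinuousOn (fun t => u t x) (Icc 0 T))
    (hh : ∀ x, ContinuousOn (fun t => h t x) (Icc 0 T))
    (hode : ∀ t ∈ Ioo 0 T, ∀ x,
      HasDerivAt (fun t => u t x) (-(M.generatorMatrix π t *ᵥ u t) x - h t x) t)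
    {s r : ℝ} (hs : s ∈ Icc 0 T) (hr : r ∈ Icc s T) {A : Set Ω}
    (hA : MeasurableSet[pathFiltration 0 T X hX.stronglyMeasurable ⟨s, hs⟩] A) :
    ∫ ω in A, u r (X r ω) ∂P + ∫ ω in A, (∫ q in s..r, h q (X q ω)) ∂P =
      ∫ ω in A, u s (X s ω) ∂P := by
  have hsub : Icc s r ⊆ Icc 0 T := Icc_subset_Icc hs.1 hr.2
  refine dynkin_formula hr.1 (fun q hq => hX.measurable q (hsub hq))
    (fun ω q hq => hX.right_continuous ω q ⟨hs.1.trans hq.1, hq.2.trans_le hr.2⟩)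
    (fun x y => (hπ.continuousOn_generatorMatrix x y).mono hsub) (fun f q hq => ?_)
    (fun x => (hu x).mono hsub) (fun x => (hh x).mono hsub)
    fun t ht x => hode t ⟨hs.1.trans_lt ht.1, ht.2.trans_le hr.2⟩ x
  have hcont : ∀ y, ContinuousOn (fun s => M.stateGenerator π s f y) (Icc 0 T) := fun y =>
    continuousOn_finsetSum _ fun j _ => (hπ.continuousOn_saleRate y j).mul continuousOn_const
  obtain ⟨C, -, hC⟩ := exists_forall_abs_le_of_continuousOn hcont
  have hf : ∀ y, |f y| ≤ ‖f‖ := fun y => norm_le_pi_norm f y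
  simp only [generatorMatrix_mulVec]
  exact IsMarkovJump.setIntegral_eq hX hf hcont hC hs ⟨hq.1, hq.2.trans hr.2⟩ hA

theorem IsExploratoryDynamics.memLp_accumulatedValue
    (hX : M.IsExploratoryDynamics T π x₀ P X) (hπ : M.IsAdmissible T π)
    (v : ℝ → M.State → ℝ) (t : Icc 0 T) {p : ENNReal} :
    MemLp (M.accumulatedValue γ π v X t) p P := by
  obtain ⟨C, hC⟩ := hX.exists_abs_accumulatedValue_le (γ := γ) hπ v t
  exact MemLp.of_bound (((hX.stronglyMeasurable_accumulatedValue hπ v t).mono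
    ((pathFiltration 0 T X hX.stronglyMeasurable).le t)).aestronglyMeasurable) C (.of_forall hC)

theorem IsExploratoryDynamics.martingale_accumulatedValue
    (hX : M.IsExploratoryDynamics T π x₀ P X) (hπ : M.IsAdmissible T π)
    (hu : M.SolvesBackwardEquation T γ π u) :
    Martingale (fun t : Icc 0 T => M.accumulatedValue γ π u X t)
      (pathFiltration 0 T X hX.stronglyMeasurable) P := by
  have hint : ∀ t : Icc 0 T, Integrable (M.accumulatedValue γ π u X t) P := fun t =>
    (hX.memLp_accumulatedValue hπ u t (p := 1)).integrable le_rfl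
  obtain ⟨C, -, hC⟩ := exists_forall_abs_le_of_continuousOn (hπ.continuousOn_runningReward γ)
  have hpath : ∀ a b, 0 ≤ a → a ≤ b → b ≤ T →
      (∀ ω, IntervalIntegrable (fun q => M.runningReward π γ q (X q ω)) volume a b) ∧
      Integrable (fun ω => ∫ q in a..b, M.runningReward π γ q (X q ω)) P := fun a b ha hab hb => by
    have h1 := fun s (hs : s ∈ Icc a b) => hX.measurable s ⟨ha.trans hs.1, hs.2.trans hb⟩
    have h2 := fun ω t (ht : t ∈ Ico a b) =>
      hX.right_continuous ω t ⟨ha.trans ht.1, ht.2.trans_le hb⟩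
    have h3 := fun x => (hπ.continuousOn_runningReward γ x).mono (Icc_subset_Icc ha hb)
    have h4 := fun s (hs : s ∈ Icc a b) => hC s ⟨ha.trans hs.1, hs.2.trans hb⟩
    exact ⟨intervalIntegrable_path hab h1 h2 h3 h4,
      integrable_intervalIntegral_path hab h1 h2 h3 h4 P⟩
  have huint : ∀ t ∈ Icc 0 T, Integrable (fun ω => u t (X t ω)) P := fun t ht =>
    Integrable.of_bound ((measurable_of_countable (u t)).comp
      (hX.measurable t ht)).aestronglyMeasurable ‖u t‖
      (.of_forall fun ω => norm_le_pi_norm (u t) _)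
  refine ⟨fun t => hX.stronglyMeasurable_accumulatedValue hπ u t, fun s r hsr => ?_⟩
  refine (ae_eq_condExp_of_forall_setIntegral_eq
    ((pathFiltration 0 T X hX.stronglyMeasurable).le s) (hint r)
    (fun A _ _ => (hint s).integrableOn) (fun A hA _ => ?_)
    (hX.stronglyMeasurable_accumulatedValue hπ u s).aestronglyMeasurable).symm
  have hsr' : (s : ℝ) ≤ r := hsr
  have hd := hX.dynkin hπ hu.continuousOn (hπ.continuousOn_runningReward γ) hu.hasDerivAt s.2
    ⟨hsr', r.2.2⟩ hA
  have hsplit : ∀ ω, ∫ q in 0..(r : ℝ), M.runningReward π γ q (X q ω) =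
      (∫ q in 0..(s : ℝ), M.runningReward π γ q (X q ω)) +
        ∫ q in (s : ℝ)..r, M.runningReward π γ q (X q ω) := fun ω =>
    (intervalIntegral.integral_add_adjacent_intervals
      ((hpath _ _ le_rfl s.2.1 s.2.2).1 ω) ((hpath _ _ s.2.1 hsr' r.2.2).1 ω)).symm
  simp only [accumulatedValue_eq hX.right_continuous s.2,
    accumulatedValue_eq hX.right_continuous r.2, hsplit]
  have i1 := (hpath _ _ le_rfl s.2.1 s.2.2).2
  have i2 := (hpath _ _ s.2.1 hsr' r.2.2).2
  have i3 : Integrable (fun ω => (∫ q in 0..(s : ℝ), M.runningReward π γ q (X q ω)) +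
      ∫ q in (s : ℝ)..r, M.runningReward π γ q (X q ω)) P := i1.add i2
  rw [integral_add (huint s s.2).integrableOn i1.integrableOn,
    integral_add (huint r r.2).integrableOn i3.integrableOn,
    integral_add i1.integrableOn i2.integrableOn]
  linarith

/-- For the solution `u` of the backward equation, `M^v` is a martingale if and only if `M^v` is a
modification of the martingale `M^u`. -/
theorem IsExploratoryDynamics.isSquareIntegrableValueMartingale_iff
    (hX : M.IsExploratoryDynamics T π x₀ P X) (hπ : M.IsAdmissible T π) (hT : 0 ≤ T)
    (hu : M.SolvesBackwardEquation T γ π u) (hv : ∀ x, v T x = 0) :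
    M.IsSquareIntegrableValueMartingale T γ π v P X hX.stronglyMeasurable ↔
      ∀ t ∈ Icc 0 T, ∀ᵐ ω ∂P, v t (X t ω) = u t (X t ω) := by
  have hMu := hX.martingale_accumulatedValue hπ hu
  constructor
  · rintro ⟨hMv, -⟩ t ht
    have hD := hMv.sub hMu
    have hle : (⟨t, ht⟩ : Icc 0 T) ≤ ⟨T, hT, le_rfl⟩ := ht.2
    have h := hD.condExp_ae_eq hle
    -- the integrals cancel in `M^v - M^u`, which therefore vanishes at time `T`
    have h0 : ((fun t : Icc 0 T => M.accumulatedValue γ π v X t) -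
        fun t : Icc 0 T => M.accumulatedValue γ π u X t) ⟨T, hT, le_rfl⟩ = 0 := by
      funext ω
      simp [accumulatedValue, hv, hu.terminal]
    rw [h0, condExp_zero] at h
    filter_upwards [h] with ω hω
    simp only [Pi.sub_apply, Pi.zero_apply, accumulatedValue] at hω
    linarith
  · intro h
    refine ⟨hMu.congr (fun t => hX.stronglyMeasurable_accumulatedValue hπ v t) fun t => ?_,
      fun t => hX.memLp_accumulatedValue hπ v t⟩
    filter_upwards [h t t.2] with ω hω
    simp only [accumulatedValue, hω]

/-- The process is still in its initial state `x₀` with positive probability. If `K` bounds the exit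
rate from `x₀`, then `w(t, y) = exp (K t) 1_{y = x₀}` satisfies `∂ₜw + Lw ≥ 0`, so Dynkin's formula
gives `exp (K t) P(X_t = x₀) ≥ 1`. -/
theorem IsExploratoryDynamics.measure_eq_start_ne_zero
    (hX : M.IsExploratoryDynamics T π x₀ P X) (hπ : M.IsAdmissible T π) {t : ℝ}
    (ht : t ∈ Icc 0 T) : P {ω | X t ω = x₀} ≠ 0 := by
  obtain ⟨K, -, hK⟩ := exists_forall_abs_le_of_continuousOn
    (f := fun t (_ : Unit) => M.generatorMatrix π t x₀ x₀)
    fun _ => hπ.continuousOn_generatorMatrix x₀ x₀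
  let w : ℝ → M.State → ℝ := fun s => Real.exp (K * s) • Pi.single x₀ 1
  let h : ℝ → M.State → ℝ := fun s y =>
    -(K * w s y) - Real.exp (K * s) * M.generatorMatrix π s y x₀
  have hwd : ∀ s y, HasDerivAt (fun s => w s y) (K * w s y) s := fun s y => by
    have h1 := (((hasDerivAt_id s).const_mul K).exp).mul_const ((Pi.single x₀ 1 : M.State → ℝ) y)
    refine h1.congr_deriv ?_
    simp only [w, Pi.smul_apply, smul_eq_mul, id]
    ring
  have hwc : ∀ y, Continuous fun s => w s y := fun y =>
    continuous_iff_continuousAt.2 fun s => (hwd s y).continuousAt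
  have hGw : ∀ s y, (M.generatorMatrix π s *ᵥ w s) y =
      Real.exp (K * s) * M.generatorMatrix π s y x₀ := fun s y => by
    simp only [w, Matrix.mulVec_smul, Matrix.mulVec_single_one]
    rfl
  have hhle : ∀ s ∈ Icc 0 T, ∀ y, h s y ≤ 0 := fun s hs y => by
    have he := Real.exp_pos (K * s)
    by_cases hy : y = x₀
    · subst hy
      have h1 := (abs_le.1 (hK s hs ())).1
      simp only [h, w, Pi.smul_apply, Pi.single_eq_same, smul_eq_mul, mul_one]
      nlinarith
    · have h1 := hπ.generatorMatrix_nonneg hs hy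
      have h2 : w s y = 0 := by simp [w, hy]
      have h3 := mul_nonneg he.le h1
      simp only [h, h2]
      linarith
  have hT : (0 : ℝ) ∈ Icc 0 T := ⟨le_rfl, ht.1.trans ht.2⟩
  have hd := hX.dynkin hπ (u := w) (h := h) (fun y => (hwc y).continuousOn)
    (fun y => ((continuous_const.mul (hwc y)).neg.continuousOn).sub
      ((by fun_prop : Continuous fun s => Real.exp (K * s)).continuousOn.mul
        (hπ.continuousOn_generatorMatrix y x₀)))
    (fun s hs y => (hwd s y).congr_deriv (by rw [hGw]; simp only [h]; ring)) hT ht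
    MeasurableSet.univ
  simp only [Measure.restrict_univ] at hd
  intro hzero
  have h1 : ∫ ω, w t (X t ω) ∂P = 0 := by
    refine integral_eq_zero_of_ae ?_
    have : ∀ᵐ ω ∂P, X t ω ≠ x₀ := by
      rw [ae_iff]; simpa using hzero
    filter_upwards [this] with ω hω
    simp [w, hω]
  have h2 : ∫ ω, w 0 (X 0 ω) ∂P = 1 := by
    rw [integral_congr_ae (g := fun _ => (1 : ℝ)) ?_]
    · simp
    · filter_upwards [hX.start] with ω hω
      simp [w, hω]
  have h3 : ∫ ω, (∫ q in (0 : ℝ)..t, h q (X q ω)) ∂P ≤ 0 :=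
    integral_nonpos fun ω => by
      have := intervalIntegral.integral_nonneg (μ := volume) (f := fun q => -h q (X q ω)) ht.1
        fun q hq => neg_nonneg.2 (hhle q ⟨hq.1, hq.2.trans ht.2⟩ _)
      rw [intervalIntegral.integral_neg] at this
      simpa using this
  linarith

end Exploratory

end RevenueModel

namespace RevenueModel

open scoped Matrix

/-! ### The sales process -/

section Sales

variable {m n : ℕ} {M : RevenueModel m n} {T γ t : ℝ} {π : ℝ → M.State → Finset (Fin n) → ℝ}
  {Ω : Type*} [MeasurableSpace Ω] {Q : Measure Ω}
  {N : ℝ → Ω → Fin n → ℕ} {x : M.State} {u : ℝ → M.State → ℝ}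

/-- The truncated count of product `j` grows at the sale rate of `j` until it reaches `k`. -/
theorem salesGenerator_min (x : M.State) (s : ℝ) (j : Fin n) (k : ℕ) (z : Fin n → ℕ) :
    M.salesGenerator π x s (fun z => ((min (z j) k : ℕ) : ℝ)) z =
      if z j < k then M.saleRate π s (M.remaining x z) j else 0 := by
  rw [salesGenerator, Finset.sum_eq_single j]
  · split_ifs with h
    · have h1 : min (z j + 1) k = z j + 1 := by omega
      have h2 : min (z j) k = z j := by omega
      simp [h1, h2]
    · have h1 : min (z j + 1) k = k := by omega
      have h2 : min (z j) k = k := by omega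
      simp [h1, h2]
  · intro i _ hij
    simp [Pi.single_eq_of_ne' hij]
  · simp

theorem IsSalesDynamics.measurable_remaining (hN : M.IsSalesDynamics T π t x Q N) :
    ∀ s ∈ Icc t T, Measurable fun ω => M.remaining x (N s ω) :=
  fun s hs => (measurable_of_countable (M.remaining x)).comp (hN.measurable s hs)

theorem IsSalesDynamics.rightContinuous_remaining (hN : M.IsSalesDynamics T π t x Q N) (ω : Ω) :
    ∀ s ∈ Ico t T, ContinuousWithinAt (fun s => M.remaining x (N s ω)) (Ici s) s :=
  fun s hs => (continuous_of_discreteTopology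
    (f := M.remaining x)).continuousAt.comp_continuousWithinAt (hN.right_continuous ω s hs)

variable [IsProbabilityMeasure Q]

/-- Expected sales are the expected time integral of the sale rate. The count of sales is
unbounded, so the martingale problem is applied to `min (z j) k` and `k` tends to infinity; this also
shows that the count is integrable. -/
theorem IsSalesDynamics.integral_sales (hN : M.IsSalesDynamics T π t x Q N)
    (hπ : M.IsAdmissible T π) (ht : t ∈ Icc 0 T) (j : Fin n) :
    Integrable (fun ω => (N T ω j : ℝ)) Q ∧
      ∫ ω, (N T ω j : ℝ) ∂Q =
        ∫ ω, (∫ s in t..T, M.saleRate π s (M.remaining x (N s ω)) j) ∂Q := by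
  have hsub : Icc t T ⊆ Icc 0 T := Icc_subset_Icc_left ht.1
  obtain ⟨C, hC0, hC⟩ := exists_forall_abs_le_of_continuousOn fun y =>
    hπ.continuousOn_saleRate y j
  let κ : ℕ → ℝ → (Fin n → ℕ) → ℝ := fun k s z =>
    if z j < k then M.saleRate π s (M.remaining x z) j else 0
  have hκc : ∀ k z, ContinuousOn (fun s => κ k s z) (Icc t T) := fun k z => by
    by_cases h : z j < k
    · simpa only [κ, if_pos h] using (hπ.continuousOn_saleRate _ j).mono hsub
    · simpa only [κ, if_neg h] using continuousOn_const
  have hκC : ∀ k, ∀ s ∈ Icc t T, ∀ z, |κ k s z| ≤ C := fun k s hs z => by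
    by_cases h : z j < k
    · simpa only [κ, if_pos h] using hC s (hsub hs) _
    · simpa only [κ, if_neg h, abs_zero] using hC0
  have hTm : T ∈ Icc t T := ⟨ht.2, le_rfl⟩
  have htm : t ∈ Icc t T := ⟨le_rfl, ht.2⟩
  have hmeas : ∀ k : ℕ, Measurable fun ω => ((min (N T ω j) k : ℕ) : ℝ) := fun k =>
    (measurable_of_countable fun z : Fin n → ℕ => ((min (z j) k : ℕ) : ℝ)).comp
      (hN.measurable T hTm)
  have hint : ∀ k : ℕ, Integrable (fun ω => ((min (N T ω j) k : ℕ) : ℝ)) Q := fun k =>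
    Integrable.of_bound (hmeas k).aestronglyMeasurable k (.of_forall fun ω => by
      rw [Real.norm_of_nonneg (by positivity)]; exact_mod_cast min_le_right _ _)
  have hk : ∀ k : ℕ, ∫ ω, ((min (N T ω j) k : ℕ) : ℝ) ∂Q =
      ∫ ω, (∫ s in t..T, κ k s (N s ω)) ∂Q := fun k => by
    have hgen : ∀ s z, M.salesGenerator π x s (fun z => ((min (z j) k : ℕ) : ℝ)) z = κ k s z :=
      fun s z => salesGenerator_min x s j k z
    have h := IsMarkovJump.setIntegral_eq hN (f := fun z => ((min (z j) k : ℕ) : ℝ)) (C := C)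
      (D := k) (fun z => by
        rw [abs_of_nonneg (by positivity)]; exact_mod_cast min_le_right _ _)
      (fun z => by simpa only [hgen] using hκc k z)
      (fun s hs z => by simpa only [hgen] using hκC k s hs z) htm ⟨ht.2, le_rfl⟩
      MeasurableSet.univ
    simp only [Measure.restrict_univ, hgen] at h
    have h0 : ∫ ω, ((min (N t ω j) k : ℕ) : ℝ) ∂Q = 0 := by
      refine integral_eq_zero_of_ae ?_
      filter_upwards [hN.start] with ω hω
      simp [hω]
    rw [h, h0, zero_add]
  have hlim : Tendsto (fun k : ℕ => ∫ ω, ((min (N T ω j) k : ℕ) : ℝ) ∂Q) atTop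
      (𝓝 (∫ ω, (∫ s in t..T, M.saleRate π s (M.remaining x (N s ω)) j) ∂Q)) := by
    simp only [hk]
    refine tendsto_integral_of_dominated_convergence (fun _ => C * (T - t)) (fun k => ?_)
      (integrable_const _) (fun k => .of_forall fun ω => ?_) (.of_forall fun ω => ?_)
    · exact (integrable_intervalIntegral_path ht.2 hN.measurable hN.right_continuous (hκc k)
        (hκC k) Q).aestronglyMeasurable
    · exact abs_intervalIntegral_path_le ht.2 (hκC k) ω
    · refine intervalIntegral.tendsto_integral_filter_of_dominated_convergence (fun _ => C)
        (.of_forall fun k => ?_) (.of_forall fun k => .of_forall fun s hs => ?_)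
        intervalIntegrable_const (.of_forall fun s _ => ?_)
      · exact (intervalIntegrable_path ht.2 hN.measurable hN.right_continuous (hκc k)
          (hκC k) ω).def'.aestronglyMeasurable
      · rw [uIoc_of_le ht.2] at hs
        exact hκC k s (Ioc_subset_Icc_self hs) _
      · refine tendsto_const_nhds.congr' ?_
        filter_upwards [eventually_gt_atTop (N s ω j)] with k hk
        simp only [κ, if_pos hk]
  have hmono : ∀ ω, Monotone fun k : ℕ => ((min (N T ω j) k : ℕ) : ℝ) := fun ω k l hkl => by
    simpa using min_le_min_left (N T ω j) hkl
  have hev : ∀ ω, Tendsto (fun k : ℕ => ((min (N T ω j) k : ℕ) : ℝ)) atTop (𝓝 (N T ω j : ℝ)) :=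
    fun ω => by
      refine tendsto_const_nhds.congr' ?_
      filter_upwards [eventually_ge_atTop (N T ω j)] with k hk
      rw [min_eq_left hk]
  have hNint : Integrable (fun ω => (N T ω j : ℝ)) Q := by
    have hm : Measurable fun ω => (N T ω j : ℝ) :=
      (measurable_of_countable fun z : Fin n → ℕ => (z j : ℝ)).comp (hN.measurable T hTm)
    refine ⟨hm.aestronglyMeasurable, ?_⟩
    have h1 := lintegral_tendsto_of_tendsto_of_monotone (μ := Q)
      (f := fun (k : ℕ) ω => ENNReal.ofReal ((min (N T ω j) k : ℕ) : ℝ))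
      (F := fun ω => ENNReal.ofReal (N T ω j : ℝ)) (fun k => (hmeas k).ennreal_ofReal.aemeasurable)
      (.of_forall fun ω k l hkl => ENNReal.ofReal_le_ofReal (hmono ω hkl))
      (.of_forall fun ω => ENNReal.tendsto_ofReal (hev ω))
    have h2 : ∀ k : ℕ, ∫⁻ ω, ENNReal.ofReal ((min (N T ω j) k : ℕ) : ℝ) ∂Q =
        ENNReal.ofReal (∫ ω, ((min (N T ω j) k : ℕ) : ℝ) ∂Q) := fun k =>
      (ofReal_integral_eq_lintegral_ofReal (hint k) (.of_forall fun ω => by positivity)).symm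
    simp only [h2] at h1
    have h3 := tendsto_nhds_unique h1 (ENNReal.tendsto_ofReal hlim)
    rw [hasFiniteIntegral_iff_ofReal (.of_forall fun ω => by positivity), h3]
    exact ENNReal.ofReal_lt_top
  exact ⟨hNint, tendsto_nhds_unique (integral_tendsto_of_tendsto_of_monotone hint hNint
    (.of_forall hmono) (.of_forall hev)) hlim⟩

/-- Dynkin's formula for the remaining inventory, from its deterministic value `x` at time `t` to the
terminal time, where `u` vanishes. -/
theorem IsSalesDynamics.dynkin (hN : M.IsSalesDynamics T π t x Q N) (hπ : M.IsAdmissible T π)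
    (ht : t ∈ Icc 0 T) (hu : M.SolvesBackwardEquation T γ π u) :
    ∫ ω, (∫ s in t..T, M.runningReward π γ s (M.remaining x (N s ω))) ∂Q = u t x := by
  have hsub : Icc t T ⊆ Icc 0 T := Icc_subset_Icc_left ht.1
  have htm : t ∈ Icc t T := ⟨le_rfl, ht.2⟩
  have hd := dynkin_formula (μ := Q) (Y := fun s ω => M.remaining x (N s ω)) ht.2
    hN.measurable_remaining hN.rightContinuous_remaining
    (fun y z => (hπ.continuousOn_generatorMatrix y z).mono hsub) (fun f r hr => ?_)
    (fun y => (hu.continuousOn y).mono hsub)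
    (fun y => (hπ.continuousOn_runningReward γ y).mono hsub)
    fun s hs y => hu.hasDerivAt s ⟨ht.1.trans_lt hs.1, hs.2⟩ y
  · have h1 : ∫ ω, u t (M.remaining x (N t ω)) ∂Q = u t x := by
      rw [integral_congr_ae (g := fun _ => u t x) ?_]
      · simp
      · filter_upwards [hN.start] with ω hω
        rw [hω, remaining_zero]
    rw [h1] at hd
    simpa only [hu.terminal, integral_zero, zero_add] using hd
  · have hcont : ∀ y, ContinuousOn (fun s => (M.generatorMatrix π s *ᵥ f) y) (Icc t T) :=
      fun y => continuousOn_finsetSum _ fun z _ =>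
        ((hπ.continuousOn_generatorMatrix y z).mono hsub).mul continuousOn_const
    obtain ⟨C, -, hC⟩ := exists_forall_abs_le_of_continuousOn hcont
    have h := IsMarkovJump.setIntegral_eq hN (f := fun z => f (M.remaining x z)) (C := C)
      (D := ‖f‖) (fun z => norm_le_pi_norm f _)
      (fun z => by simpa only [salesGenerator_comp_remaining] using hcont _)
      (fun s hs z => by simpa only [salesGenerator_comp_remaining] using hC s hs _) htm
      hr MeasurableSet.univ
    simpa only [Measure.restrict_univ, salesGenerator_comp_remaining] using h

end Sales

/-! ### The value function -/

section ValueFunction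

variable {m n : ℕ} {M : RevenueModel m n} {T γ : ℝ} {π : ℝ → M.State → Finset (Fin n) → ℝ}
  {Ω : Type*} [MeasurableSpace Ω] {Q : ℝ → M.State → Measure Ω}
  [∀ t x, IsProbabilityMeasure (Q t x)] {N : ℝ → M.State → ℝ → Ω → Fin n → ℕ}
  {u : ℝ → M.State → ℝ} {t : ℝ} {x : M.State}

theorem valueFunction_eq_of_solvesBackwardEquation
    (hN : M.IsSalesDynamics T π t x (Q t x) (N t x)) (hπ : M.IsAdmissible T π)
    (ht : t ∈ Icc 0 T) (hu : M.SolvesBackwardEquation T γ π u) :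
    M.valueFunction T γ π Q N t x = u t x := by
  have hsub : Icc t T ⊆ Icc 0 T := Icc_subset_Icc_left ht.1
  obtain ⟨D, -, hD⟩ := exists_forall_abs_le_of_continuousOn hπ.continuousOn_entropy
  have hE := fun y => (hπ.continuousOn_entropy y).mono hsub
  have hD' := fun s (hs : s ∈ Icc t T) => hD s (hsub hs)
  have hEi := integrable_intervalIntegral_path ht.2 hN.measurable_remaining
    hN.rightContinuous_remaining hE hD' (Q t x)
  have hEp := intervalIntegrable_path ht.2 hN.measurable_remaining
    hN.rightContinuous_remaining hE hD'
  have hRi : ∀ j, Integrable (fun ω =>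
      ∫ s in t..T, M.saleRate π s (M.remaining x (N t x s ω)) j) (Q t x) := fun j => by
    obtain ⟨C, -, hC⟩ := exists_forall_abs_le_of_continuousOn fun y => hπ.continuousOn_saleRate y j
    exact integrable_intervalIntegral_path (κ := fun s y => M.saleRate π s y j) ht.2
      hN.measurable_remaining hN.rightContinuous_remaining
      (fun y => (hπ.continuousOn_saleRate y j).mono hsub) (fun s hs => hC s (hsub hs)) (Q t x)
  have hRp : ∀ j ω, IntervalIntegrable
      (fun s => M.saleRate π s (M.remaining x (N t x s ω)) j) volume t T := fun j => by
    obtain ⟨C, -, hC⟩ := exists_forall_abs_le_of_continuousOn fun y => hπ.continuousOn_saleRate y j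
    exact intervalIntegrable_path (κ := fun s y => M.saleRate π s y j) ht.2
      hN.measurable_remaining hN.rightContinuous_remaining
      (fun y => (hπ.continuousOn_saleRate y j).mono hsub) (fun s hs => hC s (hsub hs))
  rw [← hN.dynkin hπ ht hu, valueFunction]
  have hleft : ∫ ω, ((∑ j, M.price j * ((N t x T ω j : ℝ) - (N t x t ω j : ℝ)))
      + γ * ∫ s in t..T,
        M.entropy π s (Function.leftLim (fun u => M.remaining x (N t x u ω)) s)) ∂(Q t x) =
      ∫ ω, ((∑ j, M.price j * (N t x T ω j : ℝ))
        + γ * ∫ s in t..T, M.entropy π s (M.remaining x (N t x s ω))) ∂(Q t x) := by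
    refine integral_congr_ae ?_
    filter_upwards [hN.start] with ω hω
    congr 1
    · simp [hω]
    · congr 1
      refine intervalIntegral.integral_congr_ae ?_
      filter_upwards [ae_leftLim_eq (hN.rightContinuous_remaining ω)] with s hs hmem
      rw [uIoc_of_le ht.2] at hmem
      rw [hs hmem]
  have hright : ∀ ω, ∫ s in t..T, M.runningReward π γ s (M.remaining x (N t x s ω)) =
      (∑ j, M.price j * ∫ s in t..T, M.saleRate π s (M.remaining x (N t x s ω)) j) +
        γ * ∫ s in t..T, M.entropy π s (M.remaining x (N t x s ω)) := fun ω => by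
    simp only [runningReward_eq]
    rw [intervalIntegral.integral_add
      (by
        simpa only [Finset.sum_fn] using
          IntervalIntegrable.sum Finset.univ fun j _ => (hRp j ω).const_mul (M.price j))
      ((hEp ω).const_mul _),
      intervalIntegral.integral_const_mul,
      intervalIntegral.integral_finsetSum fun j _ => (hRp j ω).const_mul _]
    simp only [intervalIntegral.integral_const_mul]
  have hS := hN.integral_sales hπ ht
  rw [hleft]
  simp only [hright]
  rw [integral_add (integrable_finsetSum _ fun j _ => (hS j).1.const_mul _) (hEi.const_mul _),
    integral_add (integrable_finsetSum _ fun j _ => (hRi j).const_mul _) (hEi.const_mul _),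
    integral_finsetSum _ fun j _ => (hS j).1.const_mul _,
    integral_finsetSum _ fun j _ => (hRi j).const_mul _]
  simp only [integral_const_mul, (hS _).2]

end ValueFunction

end RevenueModel

/-! ### The martingale characterization -/

theorem proposition1 {m n : ℕ} (M : RevenueModel m n) (T γ : ℝ) (hT : 0 < T) (hγ : 0 ≤ γ)
    (π : ℝ → M.State → Finset (Fin n) → ℝ) (hπ : M.IsAdmissible T π)
    {Ω₁ : Type*} [MeasurableSpace Ω₁] (Q : ℝ → M.State → Measure Ω₁)
    [∀ t x, IsProbabilityMeasure (Q t x)] (N : ℝ → M.State → ℝ → Ω₁ → Fin n → ℕ)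
    (hN : ∀ t ∈ Icc (0 : ℝ) T, ∀ x, M.IsSalesDynamics T π t x (Q t x) (N t x))
    {Ω₂ : Type*} [MeasurableSpace Ω₂] (P : M.State → Measure Ω₂)
    [∀ x, IsProbabilityMeasure (P x)] (X : M.State → ℝ → Ω₂ → M.State)
    (hX : ∀ x, M.IsExploratoryDynamics T π x (P x) (X x))
    (v : ℝ → M.State → ℝ) (hv : ∀ x, ContDiffOn ℝ 1 (fun t => v t x) (Icc 0 T)) :
    -- the characterization, with the exploratory process started from each initial state
    ((∀ t ∈ Icc (0 : ℝ) T, ∀ x, v t x = M.valueFunction T γ π Q N t x) ↔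
      (∀ x, v T x = 0) ∧ ∀ x₀, M.IsSquareIntegrableValueMartingale T γ π v (P x₀) (X x₀)
        (hX x₀).stronglyMeasurable) ∧
    -- the exploratory process with a single initial state, the full inventory: the same
    -- characterization of `v` at the times and states that this process reaches, and at the
    -- limits of such times
    ((∀ x, v T x = 0) →
      (M.IsSquareIntegrableValueMartingale T γ π v (P M.fullState) (X M.fullState)
          (hX M.fullState).stronglyMeasurable ↔
        ∀ x, ∀ t ∈ closure {s ∈ Icc (0 : ℝ) T | P M.fullState {ω | X M.fullState s ω = x} ≠ 0},
          v t x = M.valueFunction T γ π Q N t x)) := by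
  obtain ⟨u, hu⟩ := hπ.exists_solvesBackwardEquation hT.le γ
  have hJ : ∀ t ∈ Icc (0 : ℝ) T, ∀ x, M.valueFunction T γ π Q N t x = u t x := fun t ht x =>
    RevenueModel.valueFunction_eq_of_solvesBackwardEquation (hN t ht x) hπ ht hu
  have hTm : T ∈ Icc 0 T := ⟨hT.le, le_rfl⟩
  refine ⟨⟨fun h => ?_, fun ⟨hvT, hmart⟩ t ht x => ?_⟩, fun hvT => ⟨fun hmart x => ?_, fun h => ?_⟩⟩
  · have hvu : ∀ t ∈ Icc (0 : ℝ) T, ∀ x, v t x = u t x := fun t ht x =>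
      (h t ht x).trans (hJ t ht x)
    have hvT : ∀ x, v T x = 0 := fun x => (hvu T hTm x).trans (hu.terminal x)
    exact ⟨hvT, fun x₀ => ((hX x₀).isSquareIntegrableValueMartingale_iff hπ hT.le hu hvT).2
      fun t ht => .of_forall fun ω => hvu t ht _⟩
  · rw [hJ t ht x]
    exact RevenueModel.eq_of_ae_eq_of_measure_ne_zero
      (((hX x).isSquareIntegrableValueMartingale_iff hπ hT.le hu hvT).1 (hmart x) t ht)
      ((hX x).measure_eq_start_ne_zero hπ ht)
  · set S := {s ∈ Icc (0 : ℝ) T | P M.fullState {ω | X M.fullState s ω = x} ≠ 0}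
    have hS : closure S ⊆ {t ∈ Icc 0 T | v t x = u t x} := by
      refine closure_minimal (fun t ht => ⟨ht.1, ?_⟩) ?_
      · exact RevenueModel.eq_of_ae_eq_of_measure_ne_zero
          (((hX M.fullState).isSquareIntegrableValueMartingale_iff hπ hT.le hu hvT).1
            hmart t ht.1) ht.2
      · exact isClosed_Icc.isClosed_eq (hv x).continuousOn (hu.continuousOn x)
    intro t ht
    exact (hS ht).2.trans (hJ t (hS ht).1 x).symm
  · refine ((hX M.fullState).isSquareIntegrableValueMartingale_iff hπ hT.le hu hvT).2
      fun t ht => ?_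
    -- almost surely, the process sits at a state of positive probability
    have hae : ∀ᵐ ω ∂(P M.fullState), ∀ x, P M.fullState {ω | X M.fullState t ω = x} = 0 →
        X M.fullState t ω ≠ x := by
      refine ae_all_iff.2 fun x => ?_
      by_cases hx : P M.fullState {ω | X M.fullState t ω = x} = 0
      · filter_upwards [measure_eq_zero_iff_ae_notMem.1 hx] with ω hω _ using hω
      · exact .of_forall fun ω h0 => absurd h0 hx
    filter_upwards [hae] with ω hω
    have hne : P M.fullState {ω' | X M.fullState t ω' = X M.fullState t ω} ≠ 0 :=
      fun h0 => hω _ h0 rfl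
    rw [h _ t (subset_closure ⟨ht, hne⟩), hJ t ht]
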